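/- Let $n,d\ge 1$ and let $v_1,\dots,v_n$ be variables with finite domains $D(v)\subseteq[1,d]$. Encode $c=$ all-different$(v_1,\dots,v_n)$ by a logic program with atoms $r(v,l,u)$ (meaning $v\in[l,u]$), $sat(c)$, $violate(c)$ and the following rules, for all variables $v$ and all $1\le l\le u\le d$: \begin{align*} r(v,l,u)&\leftarrow not\ r(v,1,l-1),\ not\ r(v,u+1,d) &(5)\\ \bot&\leftarrow r(v,l,u),\ not\ r(v,l-1,u)\quad(l\ge 2) &(6)\\ \bot&\leftarrow r(v,l,u),\ not\ r(v,l,u+1)\quad(u<d) &(7)\\ violate(c)&\leftarrow u-l+2\ \{r(v_1,l,u),\dots,r(v_n,l,u)\} &(8) \end{align*} together with $sat(c)\leftarrow not\ violate(c)$ and $violate(c)\leftarrow not\ sat(c)$; the atoms $r(v,1,0)$, $r(v,d+1,d)$ of empty intervals are false. Cardinality rules are translated into normal rules by the standard counter translation ($ctr(i,j)$ means that at least $j$ of the elements from position $i$ on hold), and unit-propagation works on the completion nogoods of the resulting program, whose variables are its atoms and its rule bodies. At the root of the search tree $sat(c)$ is true, and $r(v,i,i)$ is false for each $i\in[1,d]\setminus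 D(v)$. A bound support of $v=i$ in domains $E$ is a tuple of pairwise different values in which $v$ takes the value $i$ and every other variable $w$ takes a value in $[\min E(w),\max E(w)]$; $E$ is range consistent if every $v=i$ with $i\in E(v)$ has a bound support. (a) Unit-propagation enforces range consistency at every node of the search tree. Consider any node given by decisions $v\in[l,u]$ or $v\notin[l,u]$ with $1\le l\le u\le d$ (in particular $v=i$ or $v\ne i$), and let $D'(v)\subseteq D(v)$ be the set of values that agree with them. Unit-propagation from the root literals and these decisions ends in a conflict if and only if no family of nonempty domains $E\subseteq D'$ is range consistent. Otherwise the domains $E(v)=\{i\in[1,d] : r(v,i,i)\text{ has not been derived to be false}\}$ are nonempty and are the greatest range consistent subdomains of $D'$. In particular Hall intervals are pruned: if $l\le u$ and $|\{v : E(v)\subseteq[l,u]\}|=u-l+1$, then $E(w)\cap[l,u]=\emptyset$ for every $w$ with $E(w)\not\subseteq[l,u]$. (b) The incremental counter-based unit-propagation algorithm performs this propagation at total cost $O(nd^3)$ down any branch of the search tree: there is an absolute constant $C$ such that for all $n,d\ge1$, all domains $D$ and every branch (any sequence of decisions on unassigned atoms or bodies of the program, with unit-propagation run until it halts before each further decision),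 the number of elementary steps from the root on, including reading all nogoods once, is at most $C\,n\,d^3$. Whenever the algorithm halts, it reports a conflict if and only if unit-propagation from the root literals and the decisions made so far yields one; otherwise its assignment consists of exactly the literals derived by unit-propagation. -/

import Mathlib

namespace RangeASP

/-! ### Literals, nogoods and unit-propagation -/

/-- A signed literal over the variables `V`. In rule bodies `⟨a, true⟩` is `a` and `⟨a, false⟩` is
`not a`; in nogoods and assignments they are `T a` and `F a`. -/
structure Lit (V : Type) where
  var : V
  sign : Bool
deriving DecidableEq

/-- The complementary literal. -/
def Lit.compl {V : Type} (l : Lit V) : Lit V := ⟨l.var, !l.sign⟩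

/-- Renaming of the variable of a literal. -/
def Lit.map {V W : Type} (f : V → W) (l : Lit V) : Lit W := ⟨f l.var, l.sign⟩

/-- A nogood is a finite collection of literals that must not all be true. -/
abbrev Nogood (V : Type) := List (Lit V)

/-- The literals derived by unit-propagation on the nogoods `N` from the literals `A`: whenever all
literals of a nogood but `l` have been derived, the complement of `l` is derived. -/
inductive Derived {V : Type} (N : List (Nogood V)) (A : List (Lit V)) : Lit V → Prop
  | base (l : Lit V) (h : l ∈ A) : Derived N A l
  | unit (δ : Nogood V) (hδ : δ ∈ N) (l : Lit V) (hl : l ∈ δ)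
      (h : ∀ m ∈ δ, m ≠ l → Derived N A m) : Derived N A l.compl

/-- Unit-propagation runs into a conflict: a nogood is violated or a variable gets both signs. -/
def UPConflict {V : Type} (N : List (Nogood V)) (A : List (Lit V)) : Prop :=
  (∃ δ ∈ N, ∀ l ∈ δ, Derived N A l) ∨ ∃ l, Derived N A l ∧ Derived N A l.compl

/-! ### An incremental unit-propagation engine with a step count

The counter-based propagator. It keeps, for every nogood, the number of its literals that have not
yet been processed as true. A single `step` does a bounded number of elementary operations (array
reads and writes, pushing or popping one list entry), given the occurrence lists `occ`, which are
tabulated once by reading all nogoods. -/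

/-- State of the propagator. `pending` holds the literals that are true but not yet processed,
`visit` the nogoods still to be visited for the literal being processed, and `scan` the unread
part of a nogood that is being searched for its last open literal. -/
structure State (V : Type) where
  asg : V → Option Bool
  pending : List (Lit V)
  cnt : ℕ → ℕ
  visit : List ℕ
  scan : List (Lit V)
  conflict : Bool

section Engine

variable {V : Type} [DecidableEq V]

/-- Occurrence list of a literal: the indices of the nogoods that contain it. -/
def occ (N : List (Nogood V)) (l : Lit V) : List ℕ :=
  (List.range N.length).filter (fun j => decide (l ∈ N.getD j []))

/-- Make a literal true: nothing happens if it is true already, a conflict if it is false. -/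
def State.assume (s : State V) (l : Lit V) : State V :=
  match s.asg l.var with
  | none => { s with asg := Function.update s.asg l.var (some l.sign), pending := l :: s.pending }
  | some b => if b = l.sign then s else { s with conflict := true }

/-- One elementary step; `none` when the propagator has halted, that is, in a conflict or when
nothing is left to propagate. -/
def step (N : List (Nogood V)) (s : State V) : Option (State V) :=
  if s.conflict then none else
  match s.scan with
  | l :: rest =>
    match s.asg l.var with
    | none => some ({ s with scan := [] }.assume l.compl)
    | some b => some (if b = l.sign then { s with scan := rest } else { s with scan := [] })
  | [] =>
    match s.visit with
    | j :: js =>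
      let c := s.cnt j - 1
      some { s with
        visit := js
        cnt := Function.update s.cnt j c
        scan := if c = 1 then N.getD j [] else []
        conflict := decide (c = 0) }
    | [] =>
      match s.pending with
      | l :: ls => some { s with pending := ls, visit := occ N l }
      | [] => none

/-- The literals forced by the nogoods with a single element. -/
def unitLits (N : List (Nogood V)) : List (Lit V) :=
  N.filterMap (fun δ => match δ with
    | [l] => some l.compl
    | _ => none)

/-- The initial state at the root of the search tree, given the literals `A` that hold there. -/
def initState (N : List (Nogood V)) (A : List (Lit V)) : State V :=
  (unitLits N ++ A).foldl State.assume
    { asg := fun _ => none, pending := [], cnt := fun j => (N.getD j []).length,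
      visit := [], scan := [], conflict := N.any List.isEmpty }

/-- Cost of setting up the counters, the occurrence lists and the initial state: one unit for each
nogood, for each literal occurrence in a nogood and for each root literal. -/
def initCost (N : List (Nogood V)) (A : List (Lit V)) : ℕ :=
  N.length + (N.map List.length).sum + A.length

/-- `Branch N A ds s c`: on a branch of the search tree whose root has the literals `A`, after the
decisions `ds` (in this order) the propagator can be in state `s`, and the cost accumulated since
the root, including the initialisation, is `c`. Propagation is run until the propagator halts;
if there is no conflict, any unassigned variable may be decided next, with either sign. -/
inductive Branch (N : List (Nogood V)) (A : List (Lit V)) :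
    List (Lit V) → State V → ℕ → Prop
  | root : Branch N A [] (initState N A) (initCost N A)
  | propagate (ds : List (Lit V)) (s s' : State V) (c : ℕ) (h : Branch N A ds s c)
      (hs : step N s = some s') : Branch N A ds s' (c + 1)
  | decision (ds : List (Lit V)) (s : State V) (c : ℕ) (l : Lit V) (h : Branch N A ds s c)
      (hs : step N s = none) (hc : s.conflict = false)
      (hv : ∃ δ ∈ N, ∃ m ∈ δ, m.var = l.var) (hl : s.asg l.var = none) :
      Branch N A (ds ++ [l]) (s.assume l) (c + 1)

end Engine

/-! ### Logic programs and their nogoods -/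

/-- A normal rule `head ← body`; the head `none` is `⊥` (an integrity constraint). -/
structure Rule (α : Type) where
  head : Option α
  body : List (Lit α)
deriving DecidableEq

/-- A cardinality rule `head ← bound {elems}`. -/
structure CardRule (α : Type) where
  head : α
  bound : ℕ
  elems : List (Lit α)
deriving DecidableEq

/-- A logic program with cardinality rules. -/
structure Program (α : Type) where
  rules : List (Rule α)
  cards : List (CardRule α)

/-- Atoms of the normal program that results from translating the cardinality rules: `ctr ρ i j`
says that at least `j` of the literals of `ρ` from position `i` on (counted from 0) hold. -/
inductive CAtom (α : Type)
  | base (a : α) : CAtom α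
  | ctr (ρ : CardRule α) (i j : ℕ) : CAtom α
deriving DecidableEq

/-- The standard translation of a cardinality rule with bound `k` and `m` literals `a_i` into
normal rules:
`head ← ctr 0 k`, `ctr m 0 ←`, `ctr i j ← ctr (i+1) j` for `j ≤ k`, and
`ctr i (j+1) ← ctr (i+1) j, a_i` for `j < k`. -/
def CardRule.translate {α : Type} (ρ : CardRule α) : List (Rule (CAtom α)) :=
  [⟨some (.base ρ.head), [⟨.ctr ρ 0 ρ.bound, true⟩]⟩,
   ⟨some (.ctr ρ ρ.elems.length 0), []⟩] ++
  ρ.elems.zipIdx.flatMap (fun p =>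
    (List.range (ρ.bound + 1)).map
      (fun j => ⟨some (.ctr ρ p.2 j), [⟨.ctr ρ (p.2 + 1) j, true⟩]⟩) ++
    (List.range ρ.bound).map
      (fun j => ⟨some (.ctr ρ p.2 (j + 1)),
        [⟨.ctr ρ (p.2 + 1) j, true⟩, p.1.map CAtom.base]⟩))

/-- The normal program of a program with cardinality rules. -/
def Program.normal {α : Type} (P : Program α) : List (Rule (CAtom α)) :=
  P.rules.map (fun r => ⟨r.head.map CAtom.base, r.body.map (Lit.map CAtom.base)⟩) ++
    P.cards.flatMap CardRule.translate

/-- The propositional variables of the nogoods of a normal program: its atoms and its bodies. -/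
inductive NVar (α : Type)
  | atom (a : α) : NVar α
  | body (b : List (Lit α)) : NVar α
deriving DecidableEq

section Completion

variable {α : Type}

/-- Nogoods of a rule with body `β`: `β` is true if all its literals are, `β` is false if one of
them is false, and the head is true if `β` is (for the head `⊥`: `β` is not true). -/
def Rule.nogoods (r : Rule α) : List (Nogood (NVar α)) :=
  (⟨.body r.body, false⟩ :: r.body.map (Lit.map NVar.atom)) ::
  ((match r.head with
    | some a => [⟨.atom a, false⟩, ⟨.body r.body, true⟩]
    | none => [⟨.body r.body, true⟩]) ::
  r.body.map (fun l => [⟨.body r.body, true⟩, (l.map NVar.atom).compl]))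

variable [DecidableEq α]

/-- The atoms that occur in a normal program. -/
def atomsOf (P : List (Rule α)) : List α :=
  (P.flatMap (fun r => r.head.toList ++ r.body.map Lit.var)).dedup

/-- An atom is not true if the bodies of all rules with this head are false. -/
def supportNogood (P : List (Rule α)) (a : α) : Nogood (NVar α) :=
  ⟨.atom a, true⟩ ::
    (P.filter (fun r => decide (r.head = some a))).map (fun r => ⟨.body r.body, false⟩)

/-- The (completion) nogoods of a normal program; each nogood is without repetitions. -/
def nogoods (P : List (Rule α)) : List (Nogood (NVar α)) :=
  (P.flatMap Rule.nogoods ++ (atomsOf P).map (supportNogood P)).map List.dedup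

end Completion

/-! ### The range encoding of all-different -/

/-- The atoms for one constraint on `n` variables: `r v l u` says that `v` takes a value in
`[l, u]`; `sat` and `violate` reify the constraint. -/
inductive Atom (n : ℕ)
  | r (v : Fin n) (l u : ℕ) : Atom n
  | sat : Atom n
  | violate : Atom n
deriving DecidableEq

/-- The nonempty intervals `[l, u]` with `1 ≤ l ≤ u ≤ d`. -/
def intervals (d : ℕ) : List (ℕ × ℕ) :=
  ((List.range' 1 d) ×ˢ (List.range' 1 d)).filter (fun p => decide (p.1 ≤ p.2))

/-- The range encoding of the variables over the domain `[1, d]`: for each variable `v` and each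
interval `[l, u]`
* `r v l u ← not r v 1 (l-1), not r v (u+1) d`,
* `⊥ ← r v l u, not r v (l-1) u`, if `l-1 ≥ 1`,
* `⊥ ← r v l u, not r v l (u+1)`, if `u+1 ≤ d`.

The atoms `r v 1 0` and `r v (d+1) d` for empty intervals head no rule and so are false. -/
def rangeRules (n d : ℕ) : List (Rule (Atom n)) :=
  (List.finRange n).flatMap (fun v => (intervals d).flatMap (fun p =>
    [⟨some (.r v p.1 p.2), [⟨.r v 1 (p.1 - 1), false⟩, ⟨.r v (p.2 + 1) d, false⟩]⟩] ++
    (if 2 ≤ p.1 then [⟨none, [⟨.r v p.1 p.2, true⟩, ⟨.r v (p.1 - 1) p.2, false⟩]⟩] else []) ++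
    (if p.2 + 1 ≤ d then [⟨none, [⟨.r v p.1 p.2, true⟩, ⟨.r v p.1 (p.2 + 1), false⟩]⟩] else [])))

/-- `sat ← not violate` and `violate ← not sat`. -/
def reifyRules (n : ℕ) : List (Rule (Atom n)) :=
  [⟨some .sat, [⟨.violate, false⟩]⟩, ⟨some .violate, [⟨.sat, false⟩]⟩]

/-- For each interval, `violate ← u-l+2 {r v₁ l u, …, r vₙ l u}`. -/
def hallRules (n d : ℕ) : List (CardRule (Atom n)) :=
  (intervals d).map (fun p =>
    ⟨.violate, p.2 - p.1 + 2, (List.finRange n).map (fun v => ⟨.r v p.1 p.2, true⟩)⟩)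

/-- The encoding of all-different on `n` variables with values in `[1, d]`. -/
def allDiffProgram (n d : ℕ) : Program (Atom n) :=
  ⟨rangeRules n d ++ reifyRules n, hallRules n d⟩

/-- The variables over which unit-propagation runs. -/
abbrev EncVar (n : ℕ) := NVar (CAtom (Atom n))

/-- The nogoods of the encoding. -/
def allDiffNogoods (n d : ℕ) : List (Nogood (EncVar n)) := nogoods (allDiffProgram n d).normal

/-- The literal `T r(v,l,u)` (`b = true`) or `F r(v,l,u)` (`b = false`). -/
def rangeLit {n : ℕ} (v : Fin n) (l u : ℕ) (b : Bool) : Lit (EncVar n) :=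
  ⟨.atom (.base (.r v l u)), b⟩

/-- The literals at the root: the constraint is to hold, and the values in `[1, d]` outside the
domain `D v` are excluded. -/
def rootLits {n : ℕ} (d : ℕ) (D : Fin n → Finset ℕ) : List (Lit (EncVar n)) :=
  ⟨.atom (.base .sat), true⟩ ::
    (List.finRange n).flatMap (fun v =>
      ((List.range' 1 d).filter (fun i => decide (i ∉ D v))).map (fun i => rangeLit v i i false))

/-- The domains at a node of the search tree: the values in `D v` that agree with every decision
`v ∈ [l, u]` or `v ∉ [l, u]` in `ds`. -/
noncomputable def nodeDomain {n : ℕ} (D : Fin n → Finset ℕ) (ds : List (Lit (EncVar n)))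
    (v : Fin n) : Finset ℕ :=
  open Classical in
  (D v).filter (fun i => ∀ (l u : ℕ) (b : Bool), rangeLit v l u b ∈ ds → (i ∈ Finset.Icc l u ↔ b))

/-- The domains after unit-propagation: the values `i ∈ [1, d]` for which `F r(v,i,i)` has not
been derived. -/
noncomputable def upDomain {n : ℕ} (d : ℕ) (A : List (Lit (EncVar n))) (v : Fin n) : Finset ℕ :=
  open Classical in
  (Finset.Icc 1 d).filter (fun i => ¬ Derived (allDiffNogoods n d) A (rangeLit v i i false))

/-! ### Range consistency -/

/-- A bound support for `v = i`: a tuple satisfying the constraint that gives `v` the value `i`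
and every other variable a value between the minimum and the maximum of its domain. -/
def HasBoundSupport {n : ℕ} (R : Set (Fin n → ℕ)) (D : Fin n → Finset ℕ) (v : Fin n) (i : ℕ) :
    Prop :=
  ∃ a ∈ R, a v = i ∧ ∀ w, w ≠ v → ∃ lo ∈ D w, ∃ hi ∈ D w, lo ≤ a w ∧ a w ≤ hi

/-- The constraint `R` is range consistent for the domains `D`. -/
def RangeConsistent {n : ℕ} (R : Set (Fin n → ℕ)) (D : Fin n → Finset ℕ) : Prop :=
  ∀ v, ∀ i ∈ D v, HasBoundSupport R D v i

/-- The all-different constraint. -/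
def AllDifferent (n : ℕ) : Set (Fin n → ℕ) := {a | Function.Injective a}

end RangeASP

/-!
The proof has two independent halves, about what unit-propagation derives from the nogoods of the
encoding, and about the propagator that computes it.

**What is derived.** Let `E` be the domains left by unit-propagation without conflict. The values
excluded at the lower end of a variable `v` propagate one after the other through the rules of
`r v i i`, so that `v` is known to lie above them, and likewise at the upper end; hence `r v l u` is
derived as soon as `E v ⊆ [l, u]` (`derived_r_true_of_outside`). Since `violate` is false, the
counter of `[l, u]` may not reach `u - l + 2`. If the interval holds `u - l + 2` domains, the
counter is in conflict (`conflict_of_overfull`); if it holds exactly `u - l + 1`, the counter makes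
`r w l u` false for all other `w`, bottom-up counts meeting top-down bounds at position `w`
(`derived_false_of_hall`). The integrity constraints pass this on to all values in the interval
(`derived_false_of_le`). So no interval is overfull and all Hall intervals are pruned, and by Hall's
marriage theorem, where for intervals it suffices to look at unions that are intervals
(`exists_overfull_interval`), the domains are range consistent (`rangeConsistent_of_hall`).

Conversely, let `E` be nonempty, range consistent and compatible with the root and the decisions.
The bound supports need not respect the holes in the domains, hence no set of solutions of
the whole encoding can serve to show that nothing more is derived. But each part of the encoding
taken alone has a suitable family of models: the ranges of one variable `v` have the values in
`E v`, and the counter of `[l, u]` has the sets of at most `u - l + 1` variables that contain all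
`v` with `E v ⊆ [l, u]` and only such `v` that `E v` meets `[l, u]`. The literals `r v l u`
shared by the parts are decided in the same way by both families, because a bound support of
`v = i` with `i ∈ [l, u]` leaves room for `v` in the interval (`agrees_counter_r`). The literals
that are true in all models of their part are therefore closed under unit-propagation
(`closedUnder_allDiffNogoods`); they are consistent and exclude no value of `E`.

**How it is computed.** The cost is bounded by a potential that pays, for each unassigned
variable, for the occurrences of both its literals, for each pending literal for its occurrences,
and for each nogood for the single scan that it undergoes when its counter drops from 2 to 1. Every
step and every decision lowers it (`potential_step`), and it is linear in the size of the
nogoods, which is `O(n d ^ 3)` (`sum_length_nogoods_le`,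
`length_allDiff_normal_le`). Correctness is an invariant (`Bookkeeping`): up to the visits still to
be made, a counter is the number of literals of its
nogood that have not been processed as true, and a nogood whose counter is 1 is either settled or
being scanned. When nothing is left to process, the assignment is closed under unit-propagation
(`Bookkeeping.halted`).
-/

namespace RangeASP

/-! ### The cost of the propagator -/

section Engine

variable {V : Type}

theorem getD_mem_or_nil (N : List (Nogood V)) (j : ℕ) : N.getD j [] ∈ N ∨ N.getD j [] = [] := by
  by_cases hj : j < N.length
  · left; simp [hj]
  · right; simp [not_lt.mp hj]

theorem mem_unitLits {N : List (Nogood V)} {l : Lit V} (h : l ∈ unitLits N) :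
    ∃ m, [m] ∈ N ∧ l = m.compl := by
  simp only [unitLits, List.mem_filterMap] at h
  obtain ⟨δ, hδ, h⟩ := h
  split at h
  · rename_i m
    exact ⟨m, hδ, by simpa using h.symm⟩
  · cases h

theorem sum_map_length_eq {α : Type} (N : List (List α)) :
    (N.map List.length).sum = ∑ j ∈ Finset.range N.length, (N.getD j []).length := by
  rw [Finset.sum_range, ← List.sum_ofFn]
  congr 1
  apply List.ext_getElem <;> simp

variable [DecidableEq V]

theorem State.assume_of_none {s : State V} {l : Lit V} (h : s.asg l.var = none) :
    s.assume l = { s with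
      asg := Function.update s.asg l.var (some l.sign), pending := l :: s.pending } := by
  simp [State.assume, h]

theorem State.assume_of_some {s : State V} {l : Lit V} {b : Bool} (h : s.asg l.var = some b) :
    s.assume l = if b = l.sign then s else { s with conflict := true } := by
  simp [State.assume, h]

/-- The steps that remain to be paid when `x` is unassigned: one for making it true or false, and
one for starting to process the literal and for each nogood visited on that account. Both signs
are counted since it is open which of them will be processed. -/
def varWeight (N : List (Nogood V)) (x : V) : ℕ :=
  2 + (occ N ⟨x, true⟩).length + (occ N ⟨x, false⟩).length

/-- An upper bound on the number of steps that the propagator can still make below the state `s`,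
decisions included, when all its literals are over `X`: a nogood is scanned when its counter drops
from 2 to 1, hence its length is owed as long as the counter is at least 2. -/
def potential (N : List (Nogood V)) (X : Finset V) (s : State V) : ℕ :=
  ∑ x ∈ X, (if s.asg x = none then varWeight N x else 0) +
    (s.pending.map (fun l => 1 + (occ N l).length)).sum + s.visit.length +
    ∑ j ∈ Finset.range N.length, (if 2 ≤ s.cnt j then (N.getD j []).length else 0) +
    s.scan.length

theorem potential_assume_of_none {N : List (Nogood V)} {X : Finset V} {s : State V} {l : Lit V}
    (hl : l.var ∈ X) (h : s.asg l.var = none) :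
    potential N X (s.assume l) + 1 ≤ potential N X s := by
  rw [State.assume_of_none h]
  have h1 : (∑ x ∈ X, if Function.update s.asg l.var (some l.sign) x = none
        then varWeight N x else 0) + varWeight N l.var
      = ∑ x ∈ X, if s.asg x = none then varWeight N x else 0 := by
    rw [← Finset.add_sum_erase X _ hl, ← Finset.add_sum_erase X _ hl]
    simp only [Function.update_self, reduceCtorEq, if_false, h, if_true, zero_add]
    rw [add_comm]
    congr 1
    refine Finset.sum_congr rfl fun x hx => ?_
    rw [Function.update_of_ne (Finset.ne_of_mem_erase hx)]
  have h2 : 2 + (occ N l).length ≤ varWeight N l.var := by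
    obtain ⟨x, b⟩ := l
    cases b <;> simp only [varWeight] <;> omega
  simp only [potential, List.map_cons, List.sum_cons]
  omega

theorem potential_assume_le {N : List (Nogood V)} {X : Finset V} {s : State V} {l : Lit V}
    (hl : l.var ∈ X) : potential N X (s.assume l) ≤ potential N X s := by
  rcases h : s.asg l.var with _ | b
  · exact (Nat.le_succ _).trans (potential_assume_of_none hl h)
  · rw [State.assume_of_some h]
    split <;> exact le_rfl

theorem State.scan_assume (s : State V) (l : Lit V) : (s.assume l).scan = s.scan := by
  unfold State.assume
  split
  · rfl
  · split <;> rfl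

theorem potential_foldl_assume_le {N : List (Nogood V)} {X : Finset V} (L : List (Lit V)) :
    ∀ s : State V, (∀ l ∈ L, l.var ∈ X) →
      potential N X (L.foldl State.assume s) ≤ potential N X s := by
  induction L with
  | nil => intro s _; exact le_rfl
  | cons l L ih =>
    intro s hL
    exact (ih _ fun m hm => hL m (List.mem_cons_of_mem _ hm)).trans
      (potential_assume_le (hL l List.mem_cons_self))

theorem scan_foldl_assume (L : List (Lit V)) :
    ∀ s : State V, (L.foldl State.assume s).scan = s.scan := by
  induction L with
  | nil => intro s; rfl
  | cons l L ih => intro s; exact (ih _).trans (s.scan_assume l)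

/-- Every step lowers the potential; that the unread part of a nogood is over `X` is needed for
the step that completes it. -/
theorem potential_step {N : List (Nogood V)} {X : Finset V} (hX : ∀ δ ∈ N, ∀ m ∈ δ, m.var ∈ X)
    {s s' : State V} (h : step N s = some s') (hs : ∀ m ∈ s.scan, m.var ∈ X) :
    (∀ m ∈ s'.scan, m.var ∈ X) ∧ potential N X s' + 1 ≤ potential N X s := by
  unfold step at h
  split at h
  · cases h
  split at h
  · rename_i l rest hscan
    rw [hscan] at hs
    split at h
    · rename_i hl
      cases h
      refine ⟨by rw [State.scan_assume]; simp, ?_⟩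
      have h1 := potential_assume_of_none (N := N) (s := { s with scan := [] }) (l := l.compl)
        (hs l List.mem_cons_self) hl
      have h2 : potential N X { s with scan := [] } ≤ potential N X s := by
        simp only [potential, List.length_nil]
        omega
      exact h1.trans h2
    · cases h
      split
      · exact ⟨fun m hm => hs m (List.mem_cons_of_mem _ hm), by simp [potential, hscan]⟩
      · exact ⟨by simp, by simp [potential, hscan]⟩
  · rename_i hscan
    split at h
    · rename_i j js hvis
      cases h
      dsimp only
      constructor
      · split
        · rcases getD_mem_or_nil N j with hj | hj
          · exact hX _ hj
          · rw [hj]; simp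
        · simp
      · have key : (∑ i ∈ Finset.range N.length,
              if 2 ≤ Function.update s.cnt j (s.cnt j - 1) i then (N.getD i []).length else 0) +
            (if s.cnt j - 1 = 1 then N.getD j [] else []).length ≤
            ∑ i ∈ Finset.range N.length, if 2 ≤ s.cnt i then (N.getD i []).length else 0 := by
          by_cases hj : j ∈ Finset.range N.length
          · rw [← Finset.add_sum_erase _ _ hj, ← Finset.add_sum_erase _ _ hj]
            have : ∀ i ∈ (Finset.range N.length).erase j,
                (if 2 ≤ Function.update s.cnt j (s.cnt j - 1) i then (N.getD i []).length else 0) =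
                if 2 ≤ s.cnt i then (N.getD i []).length else 0 := fun i hi => by
              rw [Function.update_of_ne (Finset.ne_of_mem_erase hi)]
            rw [Finset.sum_congr rfl this, Function.update_self]
            have : (if 2 ≤ s.cnt j - 1 then (N.getD j []).length else 0) +
                (if s.cnt j - 1 = 1 then N.getD j [] else []).length ≤
                if 2 ≤ s.cnt j then (N.getD j []).length else 0 := by
              split_ifs <;> first | omega | simp
            omega
          · have hnil : N.getD j [] = [] := by
              simp only [Finset.mem_range, not_lt] at hj
              simp [hj]
            rw [hnil]
            simp only [ite_self, List.length_nil, add_zero]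
            refine Finset.sum_le_sum fun i hi => ?_
            rw [Function.update_of_ne (by rintro rfl; exact hj hi)]
        simp only [potential, hscan, hvis, List.length_cons, List.length_nil]
        omega
    · rename_i hvis
      split at h
      · rename_i l ls hpend
        cases h
        refine ⟨by simp [hscan], ?_⟩
        simp only [potential, hscan, hvis, hpend, List.map_cons, List.sum_cons, List.length_nil]
        omega
      · cases h

theorem card_toFinset_vars_le (N : List (Nogood V)) (A : List (Lit V)) :
    ((N.flatten ++ A).map Lit.var).toFinset.card ≤ (N.map List.length).sum + A.length := by
  refine (List.toFinset_card_le _).trans ?_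
  simp only [List.length_map, List.length_append, List.length_flatten]
  exact le_rfl

theorem sum_occ_le (N : List (Nogood V)) (X : Finset V) :
    ∑ x ∈ X, ((occ N ⟨x, true⟩).length + (occ N ⟨x, false⟩).length) ≤ (N.map List.length).sum := by
  have hocc : ∀ l : Lit V, (occ N l).length
      = ∑ j ∈ Finset.range N.length, if l ∈ N.getD j [] then 1 else 0 := by
    intro l
    rw [Finset.sum_boole, Nat.cast_id, occ, ← List.toFinset_card_of_nodup
      (List.nodup_range.filter _)]
    congr 1
    ext j
    simp
  rw [sum_map_length_eq]
  simp only [hocc, ← Finset.sum_add_distrib]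
  rw [Finset.sum_comm]
  refine Finset.sum_le_sum fun j _ => ?_
  have h1 : ∑ x ∈ X, ((if (⟨x, true⟩ : Lit V) ∈ N.getD j [] then 1 else 0) +
      (if (⟨x, false⟩ : Lit V) ∈ N.getD j [] then 1 else 0)) =
      ∑ p ∈ X ×ˢ (Finset.univ : Finset Bool),
        if (⟨p.1, p.2⟩ : Lit V) ∈ N.getD j [] then 1 else 0 := by
    rw [Finset.sum_product]
    exact Finset.sum_congr rfl fun x _ => by rw [Fintype.sum_bool]
  rw [h1, Finset.sum_boole, Nat.cast_id]
  refine le_trans ?_ (List.toFinset_card_le (N.getD j []))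
  refine Finset.card_le_card_of_injOn (fun p => (⟨p.1, p.2⟩ : Lit V)) ?_ ?_
  · intro p hp
    simpa using (Finset.mem_filter.mp hp).2
  · rintro ⟨a, b⟩ _ ⟨a', b'⟩ _ h
    simpa using h

/-- Down any branch, the propagator works in time linear in the size of the nogoods and of the
root literals. -/
theorem Branch.cost_le {N : List (Nogood V)} {A ds : List (Lit V)} {s : State V} {c : ℕ}
    (h : Branch N A ds s c) :
    c ≤ N.length + 5 * (N.map List.length).sum + 3 * A.length := by
  set X : Finset V := ((N.flatten ++ A).map Lit.var).toFinset with hXdef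
  have hX : ∀ δ ∈ N, ∀ m ∈ δ, m.var ∈ X := by
    intro δ hδ m hm
    simp only [hXdef, List.mem_toFinset, List.mem_map, List.mem_append, List.mem_flatten]
    exact ⟨m, Or.inl ⟨δ, hδ, hm⟩, rfl⟩
  have hXA : ∀ m ∈ A, m.var ∈ X := by
    intro m hm
    simp only [hXdef, List.mem_toFinset, List.mem_map, List.mem_append, List.mem_flatten]
    exact ⟨m, Or.inr hm, rfl⟩
  have hroot : potential N X (initState N A) ≤
      4 * (N.map List.length).sum + 2 * A.length := by
    refine (potential_foldl_assume_le _ _ ?_).trans ?_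
    · intro l hl
      rcases List.mem_append.mp hl with hl | hl
      · obtain ⟨m, hm, rfl⟩ := mem_unitLits hl
        exact hX _ hm m (by simp)
      · exact hXA l hl
    · have h1 : X.card ≤ (N.map List.length).sum + A.length := card_toFinset_vars_le N A
      have h2 := sum_occ_le N X
      have h3 : ∑ j ∈ Finset.range N.length,
          (if 2 ≤ (N.getD j []).length then (N.getD j []).length else 0) ≤
          (N.map List.length).sum := by
        rw [sum_map_length_eq]
        exact Finset.sum_le_sum fun j _ => by split_ifs <;> simp
      simp only [potential, varWeight, if_true, List.map_nil, List.sum_nil, List.length_nil]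
      have h4 : ∑ x ∈ X, (2 + (occ N ⟨x, true⟩).length + (occ N ⟨x, false⟩).length) =
          2 * X.card + ∑ x ∈ X, ((occ N ⟨x, true⟩).length + (occ N ⟨x, false⟩).length) := by
        simp only [add_assoc]
        rw [Finset.sum_add_distrib, Finset.sum_const, smul_eq_mul, mul_comm]
      omega
  have main : c + potential N X s ≤ initCost N A + potential N X (initState N A) ∧
      ∀ m ∈ s.scan, m.var ∈ X := by
    induction h with
    | root => exact ⟨le_rfl, by simp [initState, scan_foldl_assume]⟩
    | propagate ds s s' c h hs ih =>
      obtain ⟨h1, h2⟩ := potential_step hX hs ih.2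
      exact ⟨by have := ih.1; omega, h1⟩
    | decision ds s c l h hs hc hv hl ih =>
      obtain ⟨δ, hδ, m, hm, hml⟩ := hv
      have h1 := potential_assume_of_none (N := N) (hml ▸ hX δ hδ m hm) hl
      exact ⟨by have := ih.1; omega, by rw [State.scan_assume]; exact ih.2⟩
  have := main.1
  simp only [initCost] at this
  omega

end Engine
/-! ### Correctness of the propagator -/

section Engine

variable {V : Type}

theorem Lit.compl_compl (l : Lit V) : l.compl.compl = l := by
  simp [Lit.compl]

theorem Derived.mono {N : List (Nogood V)} {A B : List (Lit V)} (hAB : ∀ l ∈ A, l ∈ B)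
    {l : Lit V} (h : Derived N A l) : Derived N B l := by
  induction h with
  | base l h => exact .base l (hAB l h)
  | unit δ hδ l hl _ ih => exact .unit δ hδ l hl ih

/-- The literal is true in the assignment of the state. -/
def State.Holds (s : State V) (l : Lit V) : Prop := s.asg l.var = some l.sign

theorem State.Holds.not_compl {s : State V} {l : Lit V} (h : s.Holds l) : ¬ s.Holds l.compl := by
  intro h'
  have h' : s.asg l.var = some (!l.sign) := h'
  rw [h] at h'
  simp at h'

theorem State.holds_compl_of_ne {s : State V} {l : Lit V} {b : Bool} (h : s.asg l.var = some b)
    (hb : b ≠ l.sign) : s.Holds l.compl := by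
  have : b = !l.sign := by cases b <;> cases h : l.sign <;> simp_all
  exact h.trans (congrArg some this)

/-- `δ` needs no scan: one of its literals is false, or all of them are true, in which case the
conflict is noticed when the last of them is processed. -/
def State.Settled (s : State V) (δ : Nogood V) : Prop :=
  (∃ m ∈ δ, s.Holds m.compl) ∨ ∀ m ∈ δ, s.Holds m

/-- The `j`-th nogood may be the one being scanned: it has no visit ahead, and all its literals
before the unread part are true. -/
def State.Scanned (N : List (Nogood V)) (s : State V) (j : ℕ) : Prop :=
  j ∉ s.visit ∧ ∃ pre, N.getD j [] = pre ++ s.scan ∧ ∀ m ∈ pre, s.Holds m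

variable [DecidableEq V]

/-- The bookkeeping of the propagator in a state without conflict. `Q` is the set of processed
literals, the one being processed included; so a counter is ahead of the number of literals
outside `Q` by the visit still to be made. -/
structure Bookkeeping (N : List (Nogood V)) (A : List (Lit V)) (s : State V)
    (Q : Finset (Lit V)) : Prop where
  base : ∀ l ∈ A, s.Holds l
  holds_iff : ∀ l, s.Holds l ↔ l ∈ Q ∨ l ∈ s.pending
  pending_nodup : s.pending.Nodup
  pending_notMem : ∀ l ∈ s.pending, l ∉ Q
  visit_nodup : s.visit.Nodup
  visit_lt : ∀ j ∈ s.visit, j < N.length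
  cnt_pos : ∀ j < N.length, 1 ≤ s.cnt j
  cnt_add : ∀ j < N.length, s.cnt j + ((N.getD j []).filter (· ∈ Q)).length =
    (N.getD j []).length + s.visit.count j
  scanned : s.scan ≠ [] → ∃ j < N.length, s.cnt j = 1 ∧ s.Scanned N j
  settled : ∀ j < N.length, s.cnt j = 1 →
    s.Settled (N.getD j []) ∨ (s.scan ≠ [] ∧ s.Scanned N j)

/-- The invariant of the propagator. -/
structure Invariant (N : List (Nogood V)) (A : List (Lit V)) (s : State V) : Prop where
  sound : ∀ l, s.Holds l → Derived N A l
  conflict : s.conflict = true → UPConflict N A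
  bookkeeping : s.conflict = false → ∃ Q, Bookkeeping N A s Q

theorem State.holds_assume_iff {s : State V} {l : Lit V} (h : s.asg l.var = none) (m : Lit V) :
    (s.assume l).Holds m ↔ m = l ∨ s.Holds m := by
  rw [State.assume_of_none h]
  obtain ⟨x, b⟩ := l
  obtain ⟨y, c⟩ := m
  by_cases hxy : y = x
  · subst hxy
    have : s.asg y = none := h
    simp [State.Holds, this, eq_comm]
  · simp [State.Holds, hxy]

theorem Bookkeeping.assume {N : List (Nogood V)} {A : List (Lit V)} {s : State V}
    {Q : Finset (Lit V)} (hb : Bookkeeping N A s Q) {l : Lit V} (h : s.asg l.var = none) :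
    Bookkeeping N A (s.assume l) Q := by
  have mono : ∀ m, s.Holds m → (s.assume l).Holds m := fun m hm =>
    (State.holds_assume_iff h m).2 (Or.inr hm)
  have hl : ¬ s.Holds l := by simp [State.Holds, h]
  have hl' := not_or.1 (mt (hb.holds_iff l).2 hl)
  have hscan : ∀ j, s.Scanned N j → (s.assume l).Scanned N j := by
    rintro j ⟨h1, pre, h2, h3⟩
    rw [State.Scanned, State.scan_assume]
    refine ⟨?_, pre, h2, fun m hm => mono m (h3 m hm)⟩
    rwa [State.assume_of_none h]
  constructor
  · exact fun m hm => mono m (hb.base m hm)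
  · intro m
    rw [State.holds_assume_iff h, hb.holds_iff, State.assume_of_none h]
    simp only [List.mem_cons]
    tauto
  · rw [State.assume_of_none h]
    exact List.nodup_cons.2 ⟨hl'.2, hb.pending_nodup⟩
  · rw [State.assume_of_none h]
    intro m hm
    rcases List.mem_cons.1 hm with rfl | hm
    · exact hl'.1
    · exact hb.pending_notMem m hm
  · rw [State.assume_of_none h]; exact hb.visit_nodup
  · rw [State.assume_of_none h]; exact hb.visit_lt
  · rw [State.assume_of_none h]; exact hb.cnt_pos
  · rw [State.assume_of_none h]; exact hb.cnt_add
  · rw [State.scan_assume]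
    intro hs
    obtain ⟨j, hj, h1, h2⟩ := hb.scanned hs
    refine ⟨j, hj, ?_, hscan j h2⟩
    rwa [State.assume_of_none h]
  · intro j hj hc
    rw [State.scan_assume]
    have hc : s.cnt j = 1 := by rwa [State.assume_of_none h] at hc
    rcases hb.settled j hj hc with (⟨m, hm, h1⟩ | h1) | h1
    · exact Or.inl (Or.inl ⟨m, hm, mono _ h1⟩)
    · exact Or.inl (Or.inr fun m hm => mono _ (h1 m hm))
    · exact Or.inr ⟨h1.1, hscan j h1.2⟩

theorem Bookkeeping.clear_scan {N : List (Nogood V)} {A : List (Lit V)} {s : State V}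
    {Q : Finset (Lit V)} (hb : Bookkeeping N A s Q)
    (h : ∀ j < N.length, s.scan ≠ [] → s.Scanned N j → s.Settled (N.getD j [])) :
    Bookkeeping N A { s with scan := [] } Q where
  base := hb.base
  holds_iff := hb.holds_iff
  pending_nodup := hb.pending_nodup
  pending_notMem := hb.pending_notMem
  visit_nodup := hb.visit_nodup
  visit_lt := hb.visit_lt
  cnt_pos := hb.cnt_pos
  cnt_add := hb.cnt_add
  scanned := by simp
  settled := fun j hj hc => Or.inl <| (hb.settled j hj hc).elim id fun h1 => h j hj h1.1 h1.2

theorem Invariant.assume {N : List (Nogood V)} {A : List (Lit V)} {s : State V}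
    (hi : Invariant N A s) {l : Lit V} (h : s.asg l.var = none) (hl : Derived N A l) :
    Invariant N A (s.assume l) where
  sound := fun m hm => ((State.holds_assume_iff h m).1 hm).elim (fun e => e ▸ hl) (hi.sound m)
  conflict := by rw [State.assume_of_none h]; exact hi.conflict
  bookkeeping := fun hc => by
    rw [State.assume_of_none h] at hc
    obtain ⟨Q, hQ⟩ := hi.bookkeeping hc
    exact ⟨Q, hQ.assume h⟩

omit [DecidableEq V] in
theorem forall_of_length_filter {δ : List (Lit V)} {p : Lit V → Bool}
    (h : (δ.filter p).length + 1 = δ.length) {l : Lit V} (hl : l ∈ δ) (hpl : p l = false) :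
    ∀ m ∈ δ, m ≠ l → p m = true := by
  intro m hm hml
  by_contra hpm
  have h1 := List.length_eq_length_filter_add (l := δ) p
  have h2 : (δ.filter (fun x => !p x)).length = 1 := by omega
  obtain ⟨x, hx⟩ := List.length_eq_one_iff.1 h2
  have h3 : l ∈ δ.filter (fun x => !p x) := by simp [hl, hpl]
  have h4 : m ∈ δ.filter (fun x => !p x) := by
    simpa [hm] using hpm
  rw [hx, List.mem_singleton] at h3 h4
  exact hml (h4.trans h3.symm)

theorem mem_occ {N : List (Nogood V)} {l : Lit V} {j : ℕ} :
    j ∈ occ N l ↔ j < N.length ∧ l ∈ N.getD j [] := by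
  simp [occ]

theorem nodup_occ (N : List (Nogood V)) (l : Lit V) : (occ N l).Nodup :=
  List.nodup_range.filter _

/-- Processing a further literal `l`. -/
theorem length_filter_insert {δ : List (Lit V)} (hδ : δ.Nodup) {Q : Finset (Lit V)} {l : Lit V}
    (hl : l ∉ Q) : (δ.filter (· ∈ insert l Q)).length =
      (δ.filter (· ∈ Q)).length + if l ∈ δ then 1 else 0 := by
  have h1 : ∀ R : Finset (Lit V), (δ.filter (· ∈ R)).length = (δ.toFinset ∩ R).card := by
    intro R
    rw [← List.toFinset_card_of_nodup (hδ.filter _)]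
    congr 1
    ext m
    simp
  rw [h1, h1]
  split_ifs with h
  · rw [Finset.inter_insert_of_mem (by simpa using h), Finset.card_insert_of_notMem (by simp [hl])]
  · rw [Finset.inter_insert_of_notMem (by simpa using h), add_zero]

theorem Invariant.step {N : List (Nogood V)} (hN : ∀ δ ∈ N, δ.Nodup) {A : List (Lit V)}
    {s s' : State V} (hi : Invariant N A s) (h : step N s = some s') : Invariant N A s' := by
  have hN' : ∀ j, (N.getD j []).Nodup := fun j => by
    rcases getD_mem_or_nil N j with hj | hj
    · exact hN _ hj
    · rw [hj]; exact List.nodup_nil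
  unfold RangeASP.step at h
  split at h
  · cases h
  rename_i hconf
  have hconf : s.conflict = false := by simpa using hconf
  obtain ⟨Q, hQ⟩ := hi.bookkeeping hconf
  split at h
  · rename_i l rest hscan
    have hl : ∀ j, s.Scanned N j → l ∈ N.getD j [] := by
      rintro j ⟨-, pre, hpre, -⟩
      rw [hpre, hscan]; simp
    split at h
    · rename_i hlnone
      cases h
      have hd : Derived N A l.compl := by
        obtain ⟨j, hj, hc, hs⟩ := hQ.scanned (by simp [hscan])
        have hcnt := hQ.cnt_add j hj
        rw [hc, List.count_eq_zero_of_not_mem hs.1] at hcnt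
        have hlQ : l ∉ Q := fun hlQ => by
          have := (hQ.holds_iff l).2 (Or.inl hlQ)
          simp [State.Holds, hlnone] at this
        refine .unit _ ?_ l (hl j hs) fun m hm hml => hi.sound m ((hQ.holds_iff m).2 (Or.inl ?_))
        · simp [hj]
        · simpa using forall_of_length_filter (p := (· ∈ Q)) (by omega) (hl j hs)
            (by simpa using hlQ) m hm hml
      have h1 : s.asg l.compl.var = none := hlnone
      have h2 := hi.assume h1 hd
      have h3 : ({ s with scan := [] } : State V).assume l.compl =
          { s.assume l.compl with scan := [] } := by
        rw [State.assume_of_none h1, State.assume_of_none (s := { s with scan := [] }) h1]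
      rw [h3]
      refine ⟨h2.sound, h2.conflict, fun _ => ⟨Q, (hQ.assume h1).clear_scan ?_⟩⟩
      rintro j - - ⟨-, pre, hpre, -⟩
      refine Or.inl ⟨l, ?_, (State.holds_assume_iff h1 _).2 (Or.inl rfl)⟩
      rw [hpre, State.scan_assume, hscan]; simp
    · rename_i b hlb
      cases h
      by_cases hb : b = l.sign
      · rw [if_pos hb]
        have hlh : s.Holds l := hlb.trans (congrArg some hb)
        have hstep : ∀ j, s.Scanned N j → ({ s with scan := rest } : State V).Scanned N j := by
          rintro j ⟨h1, pre, h2, h3⟩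
          refine ⟨h1, pre ++ [l], by rw [h2, hscan]; simp, fun m hm => ?_⟩
          rcases List.mem_append.1 hm with hm | hm
          · exact h3 m hm
          · rw [List.mem_singleton.1 hm]; exact hlh
        refine ⟨hi.sound, hi.conflict, fun _ => ⟨Q, ?_⟩⟩
        refine ⟨hQ.base, hQ.holds_iff, hQ.pending_nodup, hQ.pending_notMem, hQ.visit_nodup,
          hQ.visit_lt, hQ.cnt_pos, hQ.cnt_add, fun _ => ?_, fun j hj hc => ?_⟩
        · obtain ⟨j, hj, hc, hs⟩ := hQ.scanned (by simp [hscan])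
          exact ⟨j, hj, hc, hstep j hs⟩
        · rcases hQ.settled j hj hc with h1 | ⟨-, h1⟩
          · exact Or.inl h1
          · have h2 := hstep j h1
            by_cases hr : rest = []
            · left; right
              obtain ⟨-, pre, h3, h4⟩ := h2
              intro m hm
              rw [h3, hr] at hm
              exact h4 m (by simpa using hm)
            · exact Or.inr ⟨hr, h2⟩
      · rw [if_neg hb]
        refine ⟨hi.sound, hi.conflict, fun _ => ⟨Q, hQ.clear_scan fun j _ _ hs => ?_⟩⟩
        exact Or.inl ⟨l, hl j hs, State.holds_compl_of_ne hlb hb⟩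
  · rename_i hscan
    split at h
    · rename_i j js hvis
      have hj : j < N.length := hQ.visit_lt j (by simp [hvis])
      have hnd := hQ.visit_nodup
      rw [hvis, List.nodup_cons] at hnd
      have hcnt := hQ.cnt_add j hj
      have hpos := hQ.cnt_pos j hj
      rw [hvis, List.count_cons_self, List.count_eq_zero_of_not_mem hnd.1] at hcnt
      cases h
      refine ⟨hi.sound, fun hc => ?_, fun hc => ⟨Q, ?_⟩⟩
      · have hc : s.cnt j - 1 = 0 := by simpa using hc
        refine Or.inl ⟨N.getD j [], by simp [hj], fun m hm => hi.sound m ?_⟩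
        have := (List.length_filter_eq_length_iff (p := (· ∈ Q)) (l := N.getD j [])).1
          (by omega) m hm
        exact (hQ.holds_iff m).2 (Or.inl (by simpa using this))
      · have hc : s.cnt j - 1 ≠ 0 := by simpa using hc
        refine ⟨hQ.base, hQ.holds_iff, hQ.pending_nodup, hQ.pending_notMem, hnd.2,
          fun i hi => hQ.visit_lt i (by simp [hvis, hi]), fun i hi => ?_, fun i hi => ?_,
          fun hs => ?_, fun i hi hci => ?_⟩
        · by_cases hij : i = j
          · subst hij; simp; omega
          · simpa [hij] using hQ.cnt_pos i hi
        · by_cases hij : i = j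
          · subst hij
            simp only [Function.update_self, List.count_eq_zero_of_not_mem hnd.1]
            omega
          · have := hQ.cnt_add i hi
            rw [hvis, List.count_cons_of_ne (Ne.symm hij)] at this
            simpa [hij] using this
        · have h1 : s.cnt j - 1 = 1 := by
            by_contra h1
            simp [h1] at hs
          exact ⟨j, hj, by simpa using h1, hnd.1, [], by simp [h1], by simp⟩
        · by_cases hij : i = j
          · subst hij
            have h1 : s.cnt i - 1 = 1 := by simpa using hci
            by_cases hnil : N.getD i [] = []
            · rw [hnil]; left; right; simp
            · right
              simp only [h1, if_true]
              exact ⟨hnil, hnd.1, [], by simp, by simp⟩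
          · have h1 : s.cnt i = 1 := by simpa [hij] using hci
            rcases hQ.settled i hi h1 with h2 | h2
            · exact Or.inl h2
            · exact absurd hscan h2.1
    · rename_i hvis
      split at h
      · rename_i l ls hpend
        cases h
        refine ⟨hi.sound, hi.conflict, fun _ => ⟨insert l Q, ?_⟩⟩
        have hnd := hQ.pending_nodup
        rw [hpend, List.nodup_cons] at hnd
        have hlQ : l ∉ Q := hQ.pending_notMem l (by simp [hpend])
        refine ⟨hQ.base, fun m => ?_, hnd.2, fun m hm => ?_, nodup_occ N l,
          fun j hj => (mem_occ.1 hj).1, hQ.cnt_pos, fun j hj => ?_,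
          fun hs => absurd hscan hs, fun j hj hc => ?_⟩
        · have := hQ.holds_iff m
          rw [hpend, List.mem_cons] at this
          rw [Finset.mem_insert]
          exact this.trans (by tauto)
        · have h1 : m ∉ Q := hQ.pending_notMem m (by simp [hpend, hm])
          rw [Finset.mem_insert, not_or]
          exact ⟨fun e => hnd.1 (e ▸ hm), h1⟩
        · have h1 := hQ.cnt_add j hj
          rw [hvis, List.count_nil] at h1
          have h2 : (occ N l).count j = if l ∈ N.getD j [] then 1 else 0 := by
            rw [(nodup_occ N l).count]
            simp only [mem_occ, hj, true_and]
          rw [length_filter_insert (hN' j) hlQ]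
          simp only [h2]
          omega
        · rcases hQ.settled j hj hc with h2 | h2
          · exact Or.inl h2
          · exact absurd hscan h2.1
      · cases h

theorem Invariant.mono {N : List (Nogood V)} {A : List (Lit V)} {s : State V}
    (hi : Invariant N A s) {l : Lit V} (h : s.asg l.var = none) (hc : s.conflict = false) :
    Invariant N (A ++ [l]) (s.assume l) := by
  refine ⟨fun m hm => ?_, fun h1 => ?_, fun _ => ?_⟩
  · rcases (State.holds_assume_iff h m).1 hm with rfl | hm
    · exact .base _ (by simp)
    · exact (hi.sound m hm).mono (by simp +contextual)
  · rw [State.assume_of_none h] at h1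
    simp [hc] at h1
  · obtain ⟨Q, hQ⟩ := hi.bookkeeping hc
    refine ⟨Q, { hQ.assume h with base := fun m hm => ?_ }⟩
    rcases List.mem_append.1 hm with hm | hm
    · exact (hQ.assume h).base m hm
    · rw [List.mem_singleton.1 hm]
      exact (State.holds_assume_iff h l).2 (Or.inl rfl)

/-- The state while the unit and root literals are being asserted: `B` are those asserted. -/
structure Initial (N : List (Nogood V)) (A B : List (Lit V)) (s : State V) : Prop where
  sound : ∀ l, s.Holds l → Derived N A l
  conflict : s.conflict = true → UPConflict N A
  asserted : s.conflict = false → ∀ l ∈ B, s.Holds l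
  holds_iff : ∀ l, s.Holds l ↔ l ∈ s.pending
  nodup : s.pending.Nodup
  cnt : s.cnt = fun j => (N.getD j []).length
  visit : s.visit = []
  scan : s.scan = []
  no_empty : s.conflict = false → ∀ δ ∈ N, δ ≠ []

theorem Initial.assume {N : List (Nogood V)} {A B : List (Lit V)} {s : State V}
    (hs : Initial N A B s) {l : Lit V} (hl : Derived N A l) :
    Initial N A (B ++ [l]) (s.assume l) := by
  rcases h : s.asg l.var with _ | b
  · refine ⟨fun m hm => ?_, ?_, fun hc m hm => ?_, fun m => ?_, ?_, ?_, ?_, ?_, ?_⟩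
    · exact ((State.holds_assume_iff h m).1 hm).elim (fun e => e ▸ hl) (hs.sound m)
    · rw [State.assume_of_none h]; exact hs.conflict
    · rw [State.assume_of_none h] at hc
      rw [State.holds_assume_iff h]
      rcases List.mem_append.1 hm with hm | hm
      · exact Or.inr (hs.asserted hc m hm)
      · exact Or.inl (List.mem_singleton.1 hm)
    · rw [State.holds_assume_iff h, State.assume_of_none h, hs.holds_iff]
      simp
    · rw [State.assume_of_none h]
      refine List.nodup_cons.2 ⟨fun hm => ?_, hs.nodup⟩
      have := (hs.holds_iff l).2 hm
      simp [State.Holds, h] at this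
    · rw [State.assume_of_none h]; exact hs.cnt
    · rw [State.assume_of_none h]; exact hs.visit
    · rw [State.assume_of_none h]; exact hs.scan
    · rw [State.assume_of_none h]; exact hs.no_empty
  · rw [State.assume_of_some h]
    split_ifs with hb
    · refine { hs with asserted := fun hc m hm => ?_ }
      rcases List.mem_append.1 hm with hm | hm
      · exact hs.asserted hc m hm
      · rw [List.mem_singleton.1 hm, State.Holds, h, hb]
    · refine ⟨hs.sound, fun _ => Or.inr ⟨l, hl, hs.sound _ (State.holds_compl_of_ne h hb)⟩,
        by simp, hs.holds_iff, hs.nodup, hs.cnt, hs.visit, hs.scan, by simp⟩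

theorem Initial.foldl {N : List (Nogood V)} {A : List (Lit V)} (L : List (Lit V)) :
    ∀ (B : List (Lit V)) (s : State V), Initial N A B s → (∀ l ∈ L, Derived N A l) →
      Initial N A (B ++ L) (L.foldl State.assume s) := by
  induction L with
  | nil => intro B s hs _; simpa using hs
  | cons l L ih =>
    intro B s hs hL
    have := ih _ _ (hs.assume (hL l (by simp))) fun m hm => hL m (by simp [hm])
    simpa using this

omit [DecidableEq V] in
theorem derived_unitLits {N : List (Nogood V)} {A : List (Lit V)} {l : Lit V}
    (h : l ∈ unitLits N) : Derived N A l := by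
  obtain ⟨m, hm, rfl⟩ := mem_unitLits h
  exact .unit _ hm m (by simp) fun k hk hkm => absurd (List.mem_singleton.1 hk) hkm

theorem invariant_initState (N : List (Nogood V)) (A : List (Lit V)) :
    Invariant N A (initState N A) := by
  have h0 : Initial N A []
      ({ asg := fun _ => none, pending := [], cnt := fun j => (N.getD j []).length,
         visit := [], scan := [], conflict := N.any List.isEmpty } : State V) := by
    refine ⟨fun l hl => by simp [State.Holds] at hl, fun hc => ?_, by simp, by simp [State.Holds],
      List.nodup_nil, rfl, rfl, rfl, ?_⟩
    · obtain ⟨δ, hδ, h1⟩ := List.any_eq_true.1 hc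
      rw [List.isEmpty_iff] at h1
      exact Or.inl ⟨δ, hδ, by simp [h1]⟩
    · intro hc δ hδ h1
      simp only [List.any_eq_false, List.isEmpty_iff] at hc
      exact hc δ hδ h1
  have h1 : Initial N A ([] ++ (unitLits N ++ A)) (initState N A) :=
    Initial.foldl _ _ _ h0 fun l hl => (List.mem_append.1 hl).elim derived_unitLits (.base l)
  refine ⟨h1.sound, h1.conflict, fun hc => ⟨∅, ?_⟩⟩
  refine ⟨fun l hl => h1.asserted hc l (by simp [hl]), by simpa using h1.holds_iff, h1.nodup,
    by simp, by simp [h1.visit], by simp [h1.visit], fun j hj => ?_, fun j hj => ?_,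
    by simp [h1.scan], fun j hj hcj => ?_⟩
  · rw [h1.cnt]
    have : N.getD j [] ∈ N := by simp [hj]
    exact List.length_pos_iff.2 (h1.no_empty hc _ this)
  · simp [h1.cnt, h1.visit]
  · rw [h1.cnt] at hcj
    obtain ⟨l, hl⟩ := List.length_eq_one_iff.1 hcj
    refine Or.inl (Or.inl ⟨l, by rw [hl]; exact List.mem_singleton_self l, h1.asserted hc _ ?_⟩)
    have hm : [l] ∈ N := by rw [← hl]; simp [hj]
    simp only [List.nil_append, List.mem_append]
    left
    exact List.mem_filterMap.2 ⟨[l], hm, rfl⟩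

theorem Branch.invariant {N : List (Nogood V)} (hN : ∀ δ ∈ N, δ.Nodup) {A ds : List (Lit V)}
    {s : State V} {c : ℕ} (h : Branch N A ds s c) : Invariant N (A ++ ds) s := by
  induction h with
  | root => simpa using invariant_initState N A
  | propagate ds s s' c h hs ih => exact ih.step hN hs
  | decision ds s c l h hs hc hv hl ih =>
    rw [← List.append_assoc]
    exact ih.mono hl hc

/-- In a halted state without conflict the assignment is closed under unit-propagation, and no
nogood is violated. -/
theorem Bookkeeping.halted {N : List (Nogood V)} (hN : ∀ δ ∈ N, δ.Nodup)
    {A : List (Lit V)} {s : State V} {Q : Finset (Lit V)} (hQ : Bookkeeping N A s Q)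
    (h : RangeASP.step N s = none)
    (hc : s.conflict = false) :
    (∀ l, Derived N A l → s.Holds l) ∧ ∀ δ ∈ N, ¬ ∀ l ∈ δ, s.Holds l := by
  obtain ⟨h1, h2, h3⟩ : s.scan = [] ∧ s.visit = [] ∧ s.pending = [] := by
    unfold RangeASP.step at h
    rw [hc] at h
    simp only [Bool.false_eq_true, if_false] at h
    split at h
    · split at h <;> cases h
    · split at h
      · cases h
      · split at h
        · cases h
        · exact ⟨by assumption, by assumption, by assumption⟩
  have hQh : ∀ l, s.Holds l ↔ l ∈ Q := by simpa [h3] using hQ.holds_iff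
  have hnot : ∀ δ ∈ N, ¬ ∀ l ∈ δ, s.Holds l := by
    intro δ hδ hall
    obtain ⟨j, hj, rfl⟩ := List.getElem_of_mem hδ
    have h4 := hQ.cnt_add j hj
    have h5 := hQ.cnt_pos j hj
    rw [h2, List.count_nil] at h4
    have h6 := (List.length_filter_eq_length_iff (p := (· ∈ Q)) (l := N.getD j [])).2 fun m hm => by
      simpa using (hQh m).1 (hall m (by simpa [hj] using hm))
    omega
  refine ⟨fun l hl => ?_, hnot⟩
  induction hl with
  | base l hl => exact hQ.base l hl
  | unit δ hδ l hl _ ih =>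
    have hlh : ¬ s.Holds l := fun hlh => hnot δ hδ fun m hm => by
      by_cases hml : m = l
      · exact hml ▸ hlh
      · exact ih m hm hml
    obtain ⟨j, hj, hjδ⟩ := List.getElem_of_mem hδ
    have hjδ : N.getD j [] = δ := by simp [hj, hjδ]
    have h4 := hQ.cnt_add j hj
    have h5 := hQ.cnt_pos j hj
    rw [h2, List.count_nil, hjδ] at h4
    have h6 : (δ.filter (fun m => !decide (m ∈ Q))).length ≤ 1 := by
      have : Nonempty (Lit V) := ⟨l⟩
      rw [← List.toFinset_card_of_nodup ((hN δ hδ).filter _),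
        Finset.card_le_one_iff_subset_singleton]
      refine ⟨l, fun m hm => ?_⟩
      simp only [List.mem_toFinset, List.mem_filter, Bool.not_eq_true',
        decide_eq_false_iff_not] at hm
      by_contra hml
      exact hm.2 ((hQh m).1 (ih m hm.1 (by simpa using hml)))
    have h7 := List.length_eq_length_filter_add (l := δ) (· ∈ Q)
    rcases hQ.settled j hj (by omega) with (⟨m, hm, h8⟩ | h8) | h8
    · rw [hjδ] at hm
      by_cases hml : m = l
      · exact hml ▸ h8
      · exact absurd h8 (ih m hm hml).not_compl
    · rw [hjδ] at h8
      exact absurd h8 (hnot δ hδ)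
    · exact absurd h1 h8.1

/-- On every branch, a propagator that has halted has computed unit-propagation. -/
theorem Branch.halted {N : List (Nogood V)} (hN : ∀ δ ∈ N, δ.Nodup) {A ds : List (Lit V)}
    {s : State V} {c : ℕ} (h : Branch N A ds s c) (hs : RangeASP.step N s = none) :
    (s.conflict = true ↔ UPConflict N (A ++ ds)) ∧
      (s.conflict = false → ∀ x : Lit V, s.asg x.var = some x.sign ↔ Derived N (A ++ ds) x) := by
  have hi := h.invariant hN
  refine ⟨⟨hi.conflict, fun hU => ?_⟩, fun hc x => ?_⟩
  · by_contra hc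
    have hc : s.conflict = false := by simpa using hc
    obtain ⟨Q, hQ⟩ := hi.bookkeeping hc
    obtain ⟨h1, h2⟩ := hQ.halted hN hs hc
    rcases hU with ⟨δ, hδ, h3⟩ | ⟨l, h3, h4⟩
    · exact h2 δ hδ fun l hl => h1 l (h3 l hl)
    · exact (h1 l h3).not_compl (h1 _ h4)
  · obtain ⟨Q, hQ⟩ := hi.bookkeeping hc
    exact ⟨hi.sound x, (hQ.halted hN hs hc).1 x⟩

end Engine
/-! ### The size of the encoding -/

section Size

variable {α : Type}

theorem length_nogoods_rule (r : Rule α) : r.nogoods.length = r.body.length + 2 := by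
  simp [Rule.nogoods]

theorem sum_length_nogoods_rule_le (r : Rule α) :
    (r.nogoods.map List.length).sum ≤ 3 * r.body.length + 3 := by
  obtain ⟨h, b⟩ := r
  cases h <;> simp [Rule.nogoods, Function.comp_def] <;> omega

theorem sum_length_flatMap_le {β γ : Type} (f : β → List γ) (m : γ → ℕ) (K : ℕ) (L : List β)
    (h : ∀ b ∈ L, ((f b).map m).sum ≤ K) : ((L.flatMap f).map m).sum ≤ K * L.length := by
  induction L with
  | nil => simp
  | cons b L ih =>
    have h1 := ih fun c hc => h c (List.mem_cons_of_mem _ hc)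
    have h2 := h b List.mem_cons_self
    simp only [List.flatMap_cons, List.map_append, List.sum_append, List.length_cons, mul_add]
    omega

theorem length_flatMap_le {β γ : Type} (f : β → List γ) (K : ℕ) (L : List β)
    (h : ∀ b ∈ L, (f b).length ≤ K) : (L.flatMap f).length ≤ K * L.length := by
  simpa using sum_length_flatMap_le f (fun _ => 1) K L (by simpa using h)

variable [DecidableEq α]

/-- Each rule is counted for one head at most. -/
theorem sum_length_supportNogood_le (P : List (Rule α)) (as : List α) (has : as.Nodup) :
    ((as.map (supportNogood P)).map List.length).sum ≤ as.length + P.length := by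
  induction P with
  | nil => simp [supportNogood, Function.comp_def]
  | cons r P ih =>
    have h1 : ((as.map (supportNogood (r :: P))).map List.length).sum =
        ((as.map (supportNogood P)).map List.length).sum +
          as.countP (fun a => r.head = some a) := by
      clear ih has
      induction as with
      | nil => simp
      | cons a as ih =>
        simp only [List.map_cons, List.sum_cons, ih, List.countP_cons]
        by_cases ha : r.head = some a <;> simp [supportNogood, ha] <;> omega
    have h2 : as.countP (fun a => r.head = some a) ≤ 1 := by
      rcases hr : r.head with _ | b
      · simp
      · have : as.countP (fun a => some b = some a) = as.count b := by
          rw [List.count]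
          congr 1
          funext a
          rw [Bool.eq_iff_iff, beq_iff_eq, decide_eq_true_eq, Option.some.injEq, eq_comm]
        rw [this]
        exact List.nodup_iff_count_le_one.1 has b
    rw [h1, List.length_cons]
    omega

theorem length_atomsOf_le (P : List (Rule α)) (h : ∀ r ∈ P, r.body.length ≤ 2) :
    (atomsOf P).length ≤ 3 * P.length := by
  refine (List.dedup_sublist _).length_le.trans (length_flatMap_le _ _ _ fun r hr => ?_)
  have := h r hr
  rcases r.head with _ | a <;> simp <;> omega

theorem length_nogoods_le (P : List (Rule α)) (h : ∀ r ∈ P, r.body.length ≤ 2) :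
    (nogoods P).length ≤ 7 * P.length := by
  have h1 : (P.flatMap Rule.nogoods).length ≤ 4 * P.length :=
    length_flatMap_le _ _ _ fun r hr => by
      have := h r hr
      rw [length_nogoods_rule]; omega
  have h2 := length_atomsOf_le P h
  simp only [nogoods, List.length_map, List.length_append]
  omega

theorem sum_length_nogoods_le (P : List (Rule α)) (h : ∀ r ∈ P, r.body.length ≤ 2) :
    ((nogoods P).map List.length).sum ≤ 13 * P.length := by
  have h1 : ((P.flatMap Rule.nogoods).map List.length).sum ≤ 9 * P.length :=
    sum_length_flatMap_le _ _ _ _ fun r hr => by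
      have := h r hr
      exact (sum_length_nogoods_rule_le r).trans (by omega)
  have h2 := length_atomsOf_le P h
  have h3 := sum_length_supportNogood_le P (atomsOf P) (List.nodup_dedup _)
  have h4 : ((nogoods P).map List.length).sum ≤
      ((P.flatMap Rule.nogoods ++ (atomsOf P).map (supportNogood P)).map List.length).sum := by
    rw [nogoods, List.map_map]
    exact List.sum_le_sum fun δ _ => (List.dedup_sublist δ).length_le
  rw [List.map_append, List.sum_append] at h4
  omega

theorem nodup_of_mem_nogoods {P : List (Rule α)} {δ : Nogood (NVar α)} (h : δ ∈ nogoods P) :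
    δ.Nodup := by
  obtain ⟨δ', -, rfl⟩ := List.mem_map.1 h
  exact List.nodup_dedup _

end Size

theorem mem_intervals {d l u : ℕ} : (l, u) ∈ intervals d ↔ 1 ≤ l ∧ l ≤ u ∧ u ≤ d := by
  have h : (l, u) ∈ List.range' 1 d ×ˢ List.range' 1 d ↔
      l ∈ List.range' 1 d ∧ u ∈ List.range' 1 d := List.pair_mem_product
  simp only [intervals, List.mem_filter, h, List.mem_range'_1, decide_eq_true_eq]
  omega

theorem length_intervals_le (d : ℕ) : (intervals d).length ≤ d * d := by
  refine (List.length_filter_le _ _).trans ?_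
  simp [List.length_product]

/-- The cardinality rule of the interval `[l, u]`. -/
def hallRule (n l u : ℕ) : CardRule (Atom n) :=
  ⟨.violate, u - l + 2, (List.finRange n).map (fun v => ⟨.r v l u, true⟩)⟩

theorem length_translate_hallRule (n l u : ℕ) :
    (hallRule n l u).translate.length ≤ 2 + (2 * (u - l) + 5) * n := by
  have h := length_flatMap_le (fun p : Lit (Atom n) × ℕ =>
    (List.range ((hallRule n l u).bound + 1)).map
      (fun j => (⟨some (.ctr (hallRule n l u) p.2 j), [⟨.ctr (hallRule n l u) (p.2 + 1) j, true⟩]⟩ :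
        Rule (CAtom (Atom n)))) ++
    (List.range (hallRule n l u).bound).map
      (fun j => ⟨some (.ctr (hallRule n l u) p.2 (j + 1)),
        [⟨.ctr (hallRule n l u) (p.2 + 1) j, true⟩, p.1.map CAtom.base]⟩)) (2 * (u - l) + 5)
    (hallRule n l u).elems.zipIdx (fun p _ => by simp [hallRule]; omega)
  have h1 : (hallRule n l u).elems.zipIdx.length = n := by simp [hallRule]
  rw [h1] at h
  simp only [CardRule.translate, List.length_append, List.length_cons, List.length_nil]
  omega

theorem length_allDiff_normal_le {n d : ℕ} (hn : 1 ≤ n) (hd : 1 ≤ d) :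
    (allDiffProgram n d).normal.length ≤ 12 * (n * d ^ 3) := by
  have h1 : (rangeRules n d).length ≤ 3 * (d * d) * n := by
    have := length_flatMap_le (fun v : Fin n => (intervals d).flatMap (fun p =>
      ([⟨some (.r v p.1 p.2), [⟨.r v 1 (p.1 - 1), false⟩, ⟨.r v (p.2 + 1) d, false⟩]⟩] ++
      (if 2 ≤ p.1 then [⟨none, [⟨.r v p.1 p.2, true⟩, ⟨.r v (p.1 - 1) p.2, false⟩]⟩] else []) ++
      (if p.2 + 1 ≤ d then [⟨none, [⟨.r v p.1 p.2, true⟩, ⟨.r v p.1 (p.2 + 1), false⟩]⟩] else []) :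
      List (Rule (Atom n))))) (3 * (d * d)) (List.finRange n) fun v _ =>
        (length_flatMap_le _ 3 _ fun p _ => by split_ifs <;> simp).trans
          (Nat.mul_le_mul_left 3 (length_intervals_le d))
    rwa [List.length_finRange] at this
  have h2 : ((hallRules n d).flatMap CardRule.translate).length ≤
      (2 + (2 * d + 3) * n) * (d * d) := by
    refine (length_flatMap_le _ (2 + (2 * d + 3) * n) _ fun ρ hρ => ?_).trans
      (Nat.mul_le_mul_left _ (by rw [hallRules, List.length_map]; exact length_intervals_le d))
    obtain ⟨⟨l, u⟩, hp, rfl⟩ := List.mem_map.1 hρ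
    have hp := mem_intervals.1 hp
    refine (length_translate_hallRule n l u).trans ?_
    have : 2 * (u - l) + 5 ≤ 2 * d + 3 := by omega
    exact Nat.add_le_add_left (Nat.mul_le_mul_right n this) 2
  have h3 : (allDiffProgram n d).normal.length ≤
      3 * (d * d) * n + 2 + (2 + (2 * d + 3) * n) * (d * d) := by
    simp only [Program.normal, allDiffProgram, List.length_append, List.length_map, reifyRules,
      List.length_cons, List.length_nil]
    omega
  refine h3.trans ?_
  have a1 : 1 ≤ n * d ^ 3 := Nat.mul_pos hn (pow_pos hd 3)
  have a2 : d * d ≤ n * d ^ 3 := by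
    calc d * d = 1 * (d * d * 1) := by ring
      _ ≤ n * (d * d * d) := Nat.mul_le_mul hn (Nat.mul_le_mul_left _ hd)
      _ = n * d ^ 3 := by ring
  have a3 : d * d * n ≤ n * d ^ 3 := by
    calc d * d * n = n * (d * d * 1) := by ring
      _ ≤ n * (d * d * d) := Nat.mul_le_mul_left _ (Nat.mul_le_mul_left _ hd)
      _ = n * d ^ 3 := by ring
  calc 3 * (d * d) * n + 2 + (2 + (2 * d + 3) * n) * (d * d)
      = 6 * (d * d * n) + 2 + 2 * (d * d) + 2 * (n * d ^ 3) := by ring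
    _ ≤ 12 * (n * d ^ 3) := by omega

theorem length_rootLits_le {n : ℕ} (d : ℕ) (D : Fin n → Finset ℕ) :
    (rootLits d D).length ≤ 1 + d * n := by
  have := length_flatMap_le (fun v : Fin n => ((List.range' 1 d).filter
    (fun i => decide (i ∉ D v))).map (fun i => rangeLit v i i false)) d (List.finRange n)
    fun v _ => by
      rw [List.length_map]
      exact (List.length_filter_le _ _).trans (by simp)
  rw [List.length_finRange] at this
  rw [rootLits, List.length_cons]
  omega

/-! ### The rules of the encoding -/

theorem mem_translate {α : Type} {ρ : CardRule α} {r : Rule (CAtom α)} :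
    r ∈ ρ.translate ↔
      r = ⟨some (.base ρ.head), [⟨.ctr ρ 0 ρ.bound, true⟩]⟩ ∨
      r = ⟨some (.ctr ρ ρ.elems.length 0), []⟩ ∨
      ∃ i a, ρ.elems[i]? = some a ∧
        ((∃ j ≤ ρ.bound, r = ⟨some (.ctr ρ i j), [⟨.ctr ρ (i + 1) j, true⟩]⟩) ∨
        (∃ j < ρ.bound, r = ⟨some (.ctr ρ i (j + 1)),
          [⟨.ctr ρ (i + 1) j, true⟩, a.map CAtom.base]⟩)) := by
  simp only [CardRule.translate, List.mem_append, List.mem_cons, List.not_mem_nil, or_false,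
    List.mem_flatMap, List.mem_map, List.mem_range, Prod.exists, List.mem_zipIdx_iff_getElem?,
    Nat.lt_succ_iff, or_assoc, eq_comm (a := r)]
  refine or_congr_right (or_congr_right ?_)
  exact exists_comm

theorem getElem?_elems_hallRule {n l u i : ℕ} {a : Lit (Atom n)} :
    (hallRule n l u).elems[i]? = some a ↔ ∃ v : Fin n, v.val = i ∧ a = ⟨.r v l u, true⟩ := by
  simp only [hallRule, List.getElem?_map, Option.map_eq_some_iff, List.getElem?_eq_some_iff,
    List.length_finRange, List.getElem_finRange]
  constructor
  · rintro ⟨v, ⟨h, rfl⟩, rfl⟩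
    exact ⟨_, rfl, rfl⟩
  · rintro ⟨v, rfl, rfl⟩
    exact ⟨v, ⟨v.2, rfl⟩, rfl⟩

/-- The rules of the normal program of the encoding. -/
inductive IsRule (n d : ℕ) : Rule (CAtom (Atom n)) → Prop
  | range (v : Fin n) (l u : ℕ) (hl : 1 ≤ l) (hlu : l ≤ u) (hu : u ≤ d) :
    IsRule n d ⟨some (.base (.r v l u)),
      [⟨.base (.r v 1 (l - 1)), false⟩, ⟨.base (.r v (u + 1) d), false⟩]⟩
  | left (v : Fin n) (l u : ℕ) (hl : 2 ≤ l) (hlu : l ≤ u) (hu : u ≤ d) :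
    IsRule n d ⟨none, [⟨.base (.r v l u), true⟩, ⟨.base (.r v (l - 1) u), false⟩]⟩
  | right (v : Fin n) (l u : ℕ) (hl : 1 ≤ l) (hlu : l ≤ u) (hu : u + 1 ≤ d) :
    IsRule n d ⟨none, [⟨.base (.r v l u), true⟩, ⟨.base (.r v l (u + 1)), false⟩]⟩
  | sat : IsRule n d ⟨some (.base .sat), [⟨.base .violate, false⟩]⟩
  | violate : IsRule n d ⟨some (.base .violate), [⟨.base .sat, false⟩]⟩
  | hall (l u : ℕ) (hl : 1 ≤ l) (hlu : l ≤ u) (hu : u ≤ d) :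
    IsRule n d ⟨some (.base .violate), [⟨.ctr (hallRule n l u) 0 (u - l + 2), true⟩]⟩
  | ctr_zero (l u : ℕ) (hl : 1 ≤ l) (hlu : l ≤ u) (hu : u ≤ d) :
    IsRule n d ⟨some (.ctr (hallRule n l u) n 0), []⟩
  | ctr_skip (l u : ℕ) (hl : 1 ≤ l) (hlu : l ≤ u) (hu : u ≤ d) (v : Fin n) (j : ℕ)
      (hj : j ≤ u - l + 2) :
    IsRule n d ⟨some (.ctr (hallRule n l u) v j), [⟨.ctr (hallRule n l u) (v + 1) j, true⟩]⟩
  | ctr_succ (l u : ℕ) (hl : 1 ≤ l) (hlu : l ≤ u) (hu : u ≤ d) (v : Fin n) (j : ℕ)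
      (hj : j < u - l + 2) :
    IsRule n d ⟨some (.ctr (hallRule n l u) v (j + 1)),
      [⟨.ctr (hallRule n l u) (v + 1) j, true⟩, ⟨.base (.r v l u), true⟩]⟩

theorem mem_normal_iff {n d : ℕ} {r : Rule (CAtom (Atom n))} :
    r ∈ (allDiffProgram n d).normal ↔ IsRule n d r := by
  constructor
  · intro h
    rcases List.mem_append.1 h with h | h
    · obtain ⟨q, hq, rfl⟩ := List.mem_map.1 h
      rcases List.mem_append.1 hq with hq | hq
      · obtain ⟨v, -, hq⟩ := List.mem_flatMap.1 hq
        obtain ⟨⟨l, u⟩, hp, hq⟩ := List.mem_flatMap.1 hq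
        obtain ⟨hl, hlu, hu⟩ := mem_intervals.1 hp
        rcases List.mem_append.1 hq with hq | hq
        · rcases List.mem_append.1 hq with hq | hq
          · rw [List.mem_singleton.1 hq]; exact .range v l u hl hlu hu
          · split_ifs at hq with h2
            · rw [List.mem_singleton.1 hq]; exact .left v l u h2 hlu hu
            · cases hq
        · split_ifs at hq with h2
          · rw [List.mem_singleton.1 hq]; exact .right v l u hl hlu h2
          · cases hq
      · simp only [reifyRules, List.mem_cons, List.not_mem_nil, or_false] at hq
        rcases hq with rfl | rfl
        · exact .sat
        · exact .violate
    · obtain ⟨ρ, hρ, h⟩ := List.mem_flatMap.1 h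
      obtain ⟨⟨l, u⟩, hp, rfl⟩ := List.mem_map.1 hρ
      obtain ⟨hl, hlu, hu⟩ := mem_intervals.1 hp
      have h : r ∈ (hallRule n l u).translate := h
      rcases mem_translate.1 h with rfl | rfl | ⟨i, a, ha, h⟩
      · exact .hall l u hl hlu hu
      · have := IsRule.ctr_zero (n := n) l u hl hlu hu
        simpa [hallRule] using this
      · obtain ⟨v, rfl, rfl⟩ := getElem?_elems_hallRule.1 ha
        rcases h with ⟨j, hj, rfl⟩ | ⟨j, hj, rfl⟩
        · exact .ctr_skip l u hl hlu hu v j hj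
        · exact .ctr_succ l u hl hlu hu v j hj
  · intro h
    have hbase : ∀ q : Rule (Atom n), q ∈ rangeRules n d ++ reifyRules n →
        (⟨q.head.map CAtom.base, q.body.map (Lit.map CAtom.base)⟩ : Rule (CAtom (Atom n))) ∈
          (allDiffProgram n d).normal := fun q hq =>
      List.mem_append_left _ (List.mem_map.2 ⟨q, hq, rfl⟩)
    have hrange : ∀ (v : Fin n) (l u : ℕ) (q : Rule (Atom n)), (l, u) ∈ intervals d →
        q ∈ ([⟨some (.r v l u), [⟨.r v 1 (l - 1), false⟩, ⟨.r v (u + 1) d, false⟩]⟩] ++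
        (if 2 ≤ l then [⟨none, [⟨.r v l u, true⟩, ⟨.r v (l - 1) u, false⟩]⟩] else []) ++
        (if u + 1 ≤ d then [⟨none, [⟨.r v l u, true⟩, ⟨.r v l (u + 1), false⟩]⟩] else []) :
          List (Rule (Atom n))) → q ∈ rangeRules n d ++ reifyRules n := fun v l u q hp hq =>
      List.mem_append_left _ (List.mem_flatMap.2
        ⟨v, List.mem_finRange v, List.mem_flatMap.2 ⟨(l, u), hp, hq⟩⟩)
    have hhall : ∀ l u, 1 ≤ l → l ≤ u → u ≤ d → ∀ q ∈ (hallRule n l u).translate,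
        q ∈ (allDiffProgram n d).normal := fun l u hl hlu hu q hq =>
      List.mem_append_right _ (List.mem_flatMap.2
        ⟨_, List.mem_map.2 ⟨(l, u), mem_intervals.2 ⟨hl, hlu, hu⟩, rfl⟩, hq⟩)
    cases h with
    | range v l u hl hlu hu =>
      refine hbase ⟨some (.r v l u), [⟨.r v 1 (l - 1), false⟩, ⟨.r v (u + 1) d, false⟩]⟩
        (hrange v l u _ (mem_intervals.2 ⟨hl, hlu, hu⟩) (by simp))
    | left v l u hl hlu hu =>
      refine hbase ⟨none, [⟨.r v l u, true⟩, ⟨.r v (l - 1) u, false⟩]⟩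
        (hrange v l u _ (mem_intervals.2 ⟨by omega, hlu, hu⟩) (by simp [hl]))
    | right v l u hl hlu hu =>
      refine hbase ⟨none, [⟨.r v l u, true⟩, ⟨.r v l (u + 1), false⟩]⟩
        (hrange v l u _ (mem_intervals.2 ⟨hl, hlu, by omega⟩) (by simp [hu]))
    | sat => exact hbase ⟨some .sat, [⟨.violate, false⟩]⟩ (by simp [reifyRules])
    | violate => exact hbase ⟨some .violate, [⟨.sat, false⟩]⟩ (by simp [reifyRules])
    | hall l u hl hlu hu => exact hhall l u hl hlu hu _ (mem_translate.2 (Or.inl rfl))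
    | ctr_zero l u hl hlu hu =>
      exact hhall l u hl hlu hu _ (mem_translate.2 (Or.inr (Or.inl (by simp [hallRule]))))
    | ctr_skip l u hl hlu hu v j hj =>
      exact hhall l u hl hlu hu _ (mem_translate.2 (Or.inr (Or.inr
        ⟨v, _, getElem?_elems_hallRule.2 ⟨v, rfl, rfl⟩, Or.inl ⟨j, hj, rfl⟩⟩)))
    | ctr_succ l u hl hlu hu v j hj =>
      exact hhall l u hl hlu hu _ (mem_translate.2 (Or.inr (Or.inr
        ⟨v, _, getElem?_elems_hallRule.2 ⟨v, rfl, rfl⟩, Or.inr ⟨j, hj, rfl⟩⟩)))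

theorem IsRule.length_body_le {n d : ℕ} {r : Rule (CAtom (Atom n))} (h : IsRule n d r) :
    r.body.length ≤ 2 := by
  cases h <;> simp

/-- Down any branch, unit-propagation on the encoding costs `O(n d ^ 3)`. -/
theorem Branch.cost_allDiff_le {n d : ℕ} (hn : 1 ≤ n) (hd : 1 ≤ d) {D : Fin n → Finset ℕ}
    {ds : List (Lit (EncVar n))} {s : State (EncVar n)} {c : ℕ}
    (h : Branch (allDiffNogoods n d) (rootLits d D) ds s c) : c ≤ 1000 * (n * d ^ 3) := by
  have hbody : ∀ r ∈ (allDiffProgram n d).normal, r.body.length ≤ 2 := fun r hr =>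
    (mem_normal_iff.1 hr).length_body_le
  have h1 := h.cost_le
  have h2 : (allDiffNogoods n d).length ≤ _ := length_nogoods_le _ hbody
  have h3 : ((allDiffNogoods n d).map List.length).sum ≤ _ := sum_length_nogoods_le _ hbody
  have h4 := length_rootLits_le d D
  have h5 := length_allDiff_normal_le hn hd
  have h6 : 1 ≤ n * d ^ 3 := Nat.mul_pos hn (pow_pos hd 3)
  have h7 : d * n ≤ n * d ^ 3 := by
    rw [mul_comm]
    exact Nat.mul_le_mul_left n (Nat.le_self_pow (by norm_num) d)
  omega

/-! ### Unit-propagation on the nogoods of a rule -/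

section Completion

variable {α : Type} [DecidableEq α] {P : List (Rule α)} {A : List (Lit (NVar α))}

theorem mem_nogoods {δ : Nogood (NVar α)} :
    δ ∈ nogoods P ↔ ∃ δ' : Nogood (NVar α), ((∃ r ∈ P, δ' ∈ r.nogoods) ∨
      ∃ a ∈ atomsOf P, δ' = supportNogood P a) ∧ δ = δ'.dedup := by
  simp only [nogoods, List.mem_map, List.mem_append, List.mem_flatMap, eq_comm (b := δ),
    eq_comm (a := supportNogood _ _)]

theorem derived_of_nogood_rule {r : Rule α} (hr : r ∈ P) {δ : Nogood (NVar α)}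
    (hδ : δ ∈ r.nogoods) {l : Lit (NVar α)} (hl : l ∈ δ)
    (h : ∀ m ∈ δ, m ≠ l → Derived (nogoods P) A m) : Derived (nogoods P) A l.compl :=
  .unit δ.dedup (mem_nogoods.2 ⟨δ, Or.inl ⟨r, hr, hδ⟩, rfl⟩) l (List.mem_dedup.2 hl)
    fun m hm => h m (List.mem_dedup.1 hm)

theorem derived_of_supportNogood {a : α} (ha : a ∈ atomsOf P) {l : Lit (NVar α)}
    (hl : l ∈ supportNogood P a)
    (h : ∀ m ∈ supportNogood P a, m ≠ l → Derived (nogoods P) A m) :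
    Derived (nogoods P) A l.compl :=
  .unit _ (mem_nogoods.2 ⟨_, Or.inr ⟨a, ha, rfl⟩, rfl⟩) l (List.mem_dedup.2 hl)
    fun m hm => h m (List.mem_dedup.1 hm)

theorem derived_body_true {r : Rule α} (hr : r ∈ P)
    (h : ∀ l ∈ r.body, Derived (nogoods P) A (l.map .atom)) :
    Derived (nogoods P) A ⟨.body r.body, true⟩ := by
  refine derived_of_nogood_rule (l := ⟨.body r.body, false⟩) hr List.mem_cons_self
    List.mem_cons_self fun m hm hne => ?_
  obtain ⟨l, hl, rfl⟩ := List.mem_map.1 ((List.mem_cons.1 hm).resolve_left hne)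
  exact h l hl

omit [DecidableEq α] in
theorem binary_mem_nogoods {r : Rule α} {l : Lit α} (hl : l ∈ r.body) :
    [⟨.body r.body, true⟩, (l.map NVar.atom).compl] ∈ r.nogoods :=
  List.mem_cons_of_mem _ (List.mem_cons_of_mem _ (List.mem_map.2 ⟨l, hl, rfl⟩))

theorem derived_of_body_true {r : Rule α} (hr : r ∈ P) {l : Lit α} (hl : l ∈ r.body)
    (h : Derived (nogoods P) A ⟨.body r.body, true⟩) :
    Derived (nogoods P) A (l.map .atom) := by
  rw [← Lit.compl_compl (l.map NVar.atom)]
  refine derived_of_nogood_rule hr (binary_mem_nogoods hl) (by simp) fun m hm hne => ?_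
  rcases List.mem_cons.1 hm with rfl | hm
  · exact h
  · exact absurd (List.mem_singleton.1 hm) hne

theorem derived_of_body_false {r : Rule α} (hr : r ∈ P) {l : Lit α} (hl : l ∈ r.body)
    (h : Derived (nogoods P) A ⟨.body r.body, false⟩)
    (hm : ∀ m ∈ r.body, m ≠ l → Derived (nogoods P) A (m.map .atom)) :
    Derived (nogoods P) A (l.map NVar.atom).compl := by
  refine derived_of_nogood_rule hr (List.mem_cons_self (l := _))
    (List.mem_cons_of_mem _ (List.mem_map.2 ⟨l, hl, rfl⟩)) fun m hm' hne => ?_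
  rcases List.mem_cons.1 hm' with rfl | hm'
  · exact h
  · obtain ⟨k, hk, rfl⟩ := List.mem_map.1 hm'
    exact hm k hk fun e => hne (e ▸ rfl)

theorem derived_head {r : Rule α} (hr : r ∈ P) {a : α} (ha : r.head = some a)
    (h : Derived (nogoods P) A ⟨.body r.body, true⟩) :
    Derived (nogoods P) A ⟨.atom a, true⟩ := by
  refine derived_of_nogood_rule (l := ⟨.atom a, false⟩)
    (δ := [⟨.atom a, false⟩, ⟨.body r.body, true⟩]) hr (by simp [Rule.nogoods, ha])
    List.mem_cons_self fun m hm hne => ?_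
  rw [List.mem_singleton.1 ((List.mem_cons.1 hm).resolve_left hne)]
  exact h

theorem derived_body_false_of_head {r : Rule α} (hr : r ∈ P) {a : α} (ha : r.head = some a)
    (h : Derived (nogoods P) A ⟨.atom a, false⟩) :
    Derived (nogoods P) A ⟨.body r.body, false⟩ := by
  refine derived_of_nogood_rule (l := ⟨.body r.body, true⟩)
    (δ := [⟨.atom a, false⟩, ⟨.body r.body, true⟩]) hr (by simp [Rule.nogoods, ha])
    (by simp) fun m hm hne => ?_
  rcases List.mem_cons.1 hm with rfl | hm
  · exact h
  · exact absurd (List.mem_singleton.1 hm) hne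

theorem derived_body_false_of_constraint {r : Rule α} (hr : r ∈ P) (ha : r.head = none) :
    Derived (nogoods P) A ⟨.body r.body, false⟩ := by
  refine derived_of_nogood_rule (l := ⟨.body r.body, true⟩)
    (δ := [⟨.body r.body, true⟩]) hr (by simp [Rule.nogoods, ha])
    (by simp) fun m hm hne => ?_
  exact absurd (List.mem_singleton.1 hm) hne

theorem mem_atomsOf_head {r : Rule α} (hr : r ∈ P) {a : α} (ha : r.head = some a) :
    a ∈ atomsOf P :=
  List.mem_dedup.2 (List.mem_flatMap.2 ⟨r, hr, by simp [ha]⟩)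

theorem mem_atomsOf_body {r : Rule α} (hr : r ∈ P) {l : Lit α} (hl : l ∈ r.body) :
    l.var ∈ atomsOf P :=
  List.mem_dedup.2 (List.mem_flatMap.2
    ⟨r, hr, List.mem_append_right _ (List.mem_map.2 ⟨l, hl, rfl⟩)⟩)

theorem mem_supportNogood {a : α} {m : Lit (NVar α)} :
    m ∈ supportNogood P a ↔ m = ⟨.atom a, true⟩ ∨
      ∃ r ∈ P, r.head = some a ∧ m = ⟨.body r.body, false⟩ := by
  simp only [supportNogood, List.mem_cons, List.mem_map, List.mem_filter, decide_eq_true_eq,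
    and_assoc, eq_comm (b := m)]

/-- An atom that is the head of only one rule makes the body of this rule true. -/
theorem derived_body_of_unique {r : Rule α} (hr : r ∈ P) {a : α} (ha : r.head = some a)
    (hu : ∀ q ∈ P, q.head = some a → q = r) (h : Derived (nogoods P) A ⟨.atom a, true⟩) :
    Derived (nogoods P) A ⟨.body r.body, true⟩ := by
  refine derived_of_supportNogood (l := ⟨.body r.body, false⟩) (mem_atomsOf_head hr ha)
    (mem_supportNogood.2 (Or.inr ⟨r, hr, ha, rfl⟩)) fun m hm hne => ?_
  rcases mem_supportNogood.1 hm with rfl | ⟨q, hq, hqa, rfl⟩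
  · exact h
  · rw [hu q hq hqa] at hne
    exact absurd rfl hne

theorem derived_atom_false {a : α} (ha : a ∈ atomsOf P) (hu : ∀ q ∈ P, q.head ≠ some a) :
    Derived (nogoods P) A ⟨.atom a, false⟩ := by
  refine derived_of_supportNogood (l := ⟨.atom a, true⟩) ha
    (mem_supportNogood.2 (Or.inl rfl)) fun m hm hne => ?_
  rcases mem_supportNogood.1 hm with rfl | ⟨q, hq, hqa, rfl⟩
  · exact absurd rfl hne
  · exact absurd hqa (hu q hq)

end Completion

/-! ### Propagation of bounds -/

section Bounds

variable {n d : ℕ} {A : List (Lit (EncVar n))}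

/-- The rule that defines `r v l u`. -/
def rangeRule (d : ℕ) (v : Fin n) (l u : ℕ) : Rule (CAtom (Atom n)) :=
  ⟨some (.base (.r v l u)),
    [⟨.base (.r v 1 (l - 1)), false⟩, ⟨.base (.r v (u + 1) d), false⟩]⟩

theorem rangeRule_mem {v : Fin n} {l u : ℕ} (hl : 1 ≤ l) (hlu : l ≤ u) (hu : u ≤ d) :
    rangeRule d v l u ∈ (allDiffProgram n d).normal :=
  mem_normal_iff.2 (.range v l u hl hlu hu)

theorem head_eq_r {v : Fin n} {l u : ℕ} {q : Rule (CAtom (Atom n))}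
    (hq : q ∈ (allDiffProgram n d).normal) (h : q.head = some (.base (.r v l u))) :
    q = rangeRule d v l u ∧ 1 ≤ l ∧ l ≤ u ∧ u ≤ d := by
  have hq := mem_normal_iff.1 hq
  cases hq with
  | range v' l' u' hl hlu hu =>
    simp only [Option.some.injEq, CAtom.base.injEq, Atom.r.injEq] at h
    obtain ⟨rfl, rfl, rfl⟩ := h
    exact ⟨rfl, hl, hlu, hu⟩
  | _ => simp at h

theorem derived_r_true {v : Fin n} {l u : ℕ} (hl : 1 ≤ l) (hlu : l ≤ u) (hu : u ≤ d)
    (h1 : Derived (allDiffNogoods n d) A (rangeLit v 1 (l - 1) false))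
    (h2 : Derived (allDiffNogoods n d) A (rangeLit v (u + 1) d false)) :
    Derived (allDiffNogoods n d) A (rangeLit v l u true) :=
  derived_head (rangeRule_mem hl hlu hu) rfl <| derived_body_true (rangeRule_mem hl hlu hu) <| by
    simpa [rangeRule] using ⟨h1, h2⟩

theorem derived_outside_false {v : Fin n} {l u : ℕ} (hl : 1 ≤ l) (hlu : l ≤ u) (hu : u ≤ d)
    (h : Derived (allDiffNogoods n d) A (rangeLit v l u true)) :
    Derived (allDiffNogoods n d) A (rangeLit v 1 (l - 1) false) ∧
    Derived (allDiffNogoods n d) A (rangeLit v (u + 1) d false) := by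
  have hb := derived_body_of_unique (rangeRule_mem hl hlu hu) rfl
    (fun q hq hqa => (head_eq_r hq hqa).1) h
  exact ⟨derived_of_body_true (l := ⟨.base (.r v 1 (l - 1)), false⟩)
      (rangeRule_mem hl hlu hu) (by simp [rangeRule]) hb,
    derived_of_body_true (l := ⟨.base (.r v (u + 1) d), false⟩)
      (rangeRule_mem hl hlu hu) (by simp [rangeRule]) hb⟩

theorem derived_right_true {v : Fin n} {l u : ℕ} (hl : 1 ≤ l) (hlu : l ≤ u) (hu : u ≤ d)
    (h : Derived (allDiffNogoods n d) A (rangeLit v l u false))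
    (h1 : Derived (allDiffNogoods n d) A (rangeLit v 1 (l - 1) false)) :
    Derived (allDiffNogoods n d) A (rangeLit v (u + 1) d true) :=
  derived_of_body_false (l := ⟨.base (.r v (u + 1) d), false⟩) (rangeRule_mem hl hlu hu)
    (by simp [rangeRule]) (derived_body_false_of_head (rangeRule_mem hl hlu hu) rfl h) <| by
    intro m hm hne
    simp only [rangeRule, List.mem_cons, List.not_mem_nil, or_false] at hm
    rw [hm.resolve_right hne]
    exact h1

theorem derived_left_true {v : Fin n} {l u : ℕ} (hl : 1 ≤ l) (hlu : l ≤ u) (hu : u ≤ d)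
    (h : Derived (allDiffNogoods n d) A (rangeLit v l u false))
    (h1 : Derived (allDiffNogoods n d) A (rangeLit v (u + 1) d false)) :
    Derived (allDiffNogoods n d) A (rangeLit v 1 (l - 1) true) :=
  derived_of_body_false (l := ⟨.base (.r v 1 (l - 1)), false⟩) (rangeRule_mem hl hlu hu)
    (by simp [rangeRule]) (derived_body_false_of_head (rangeRule_mem hl hlu hu) rfl h) <| by
    intro m hm hne
    simp only [rangeRule, List.mem_cons, List.not_mem_nil, or_false] at hm
    rw [hm.resolve_left hne]
    exact h1

theorem derived_empty_left (hd : 1 ≤ d) (v : Fin n) :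
    Derived (allDiffNogoods n d) A (rangeLit v 1 0 false) :=
  derived_atom_false (mem_atomsOf_body (l := ⟨.base (.r v 1 0), false⟩)
      (rangeRule_mem (v := v) le_rfl hd le_rfl) (by simp [rangeRule])) fun q hq hqa => by
    have := head_eq_r hq hqa
    omega

theorem derived_empty_right (hd : 1 ≤ d) (v : Fin n) :
    Derived (allDiffNogoods n d) A (rangeLit v (d + 1) d false) :=
  derived_atom_false (mem_atomsOf_body (l := ⟨.base (.r v (d + 1) d), false⟩)
      (rangeRule_mem (v := v) le_rfl hd le_rfl) (by simp [rangeRule])) fun q hq hqa => by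
    have := head_eq_r hq hqa
    omega

/-- An integrity constraint `⊥ ← a, not b` propagates from `F b` to `F a`. -/
theorem derived_false_of_constraint {a b : CAtom (Atom n)}
    (hr : IsRule n d ⟨none, [⟨a, true⟩, ⟨b, false⟩]⟩)
    (h : Derived (allDiffNogoods n d) A ⟨.atom b, false⟩) :
    Derived (allDiffNogoods n d) A ⟨.atom a, false⟩ :=
  derived_of_body_false (l := ⟨a, true⟩) (mem_normal_iff.2 hr) (by simp)
    (derived_body_false_of_constraint (mem_normal_iff.2 hr) rfl) <| by
    intro m hm hne
    simp only [List.mem_cons, List.not_mem_nil, or_false] at hm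
    rw [hm.resolve_left hne]
    exact h

theorem derived_false_of_le {v : Fin n} {l u l' u' : ℕ} (hl : 1 ≤ l) (hu : u ≤ d) (hll : l ≤ l')
    (hlu : l' ≤ u') (huu : u' ≤ u) (h : Derived (allDiffNogoods n d) A (rangeLit v l u false)) :
    Derived (allDiffNogoods n d) A (rangeLit v l' u' false) := by
  have h1 : Derived (allDiffNogoods n d) A (rangeLit v l' u false) := by
    induction l', hll using Nat.le_induction with
    | base => exact h
    | succ k hk ih =>
      exact derived_false_of_constraint (.left v (k + 1) u (by omega) (by omega) hu)
        (ih (by omega))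
  obtain ⟨k, rfl⟩ := Nat.exists_eq_add_of_le huu
  clear h
  induction k with
  | zero => exact h1
  | succ k ih =>
    exact ih (by omega) (by omega) <| derived_false_of_constraint
      (.right v l' (u' + k) (by omega) (by omega) (by omega)) h1

theorem derived_prefix_false (hd : 1 ≤ d) {v : Fin n} {m : ℕ} (hm : m < d)
    (h : ∀ i, 1 ≤ i → i ≤ m → Derived (allDiffNogoods n d) A (rangeLit v i i false)) :
    Derived (allDiffNogoods n d) A (rangeLit v 1 m false) := by
  induction m with
  | zero => exact derived_empty_left hd v
  | succ m ih =>
    have h1 := ih (by omega) fun i hi him => h i hi (by omega)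
    have h2 := derived_right_true (l := m + 1) (by omega) le_rfl (by omega)
      (h (m + 1) (by omega) le_rfl) h1
    exact (derived_outside_false (by omega) (by omega) le_rfl h2).1

theorem derived_suffix_false (hd : 1 ≤ d) {v : Fin n} {m : ℕ} (hm : 1 ≤ m) (hmd : m ≤ d)
    (h : ∀ i, m < i → i ≤ d → Derived (allDiffNogoods n d) A (rangeLit v i i false)) :
    Derived (allDiffNogoods n d) A (rangeLit v (m + 1) d false) := by
  induction hmd using Nat.decreasingInduction with
  | self => exact derived_empty_right hd v
  | of_succ m hmd ih =>
    have h1 := ih (by omega) fun i hi him => h i (by omega) him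
    have h2 := derived_left_true (l := m + 1) (by omega) le_rfl (by omega)
      (h (m + 1) (by omega) (by omega)) h1
    exact (derived_outside_false le_rfl hm (by omega) h2).2

/-- If all values outside an interval are excluded, the variable is known to be inside. -/
theorem derived_r_true_of_outside {v : Fin n} {l u : ℕ} (hl : 1 ≤ l) (hlu : l ≤ u) (hu : u ≤ d)
    (h : ∀ i, 1 ≤ i → i ≤ d → ¬ (l ≤ i ∧ i ≤ u) →
      Derived (allDiffNogoods n d) A (rangeLit v i i false)) :
    Derived (allDiffNogoods n d) A (rangeLit v l u true) :=
  derived_r_true hl hlu hu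
    (derived_prefix_false (by omega) (by omega) fun i _ _ => h i (by omega) (by omega) (by omega))
    (derived_suffix_false (by omega) (by omega) hu
      fun i _ _ => h i (by omega) (by omega) (by omega))

theorem conflict_of_all_excluded (hd : 1 ≤ d) {v : Fin n}
    (h : ∀ i, 1 ≤ i → i ≤ d → Derived (allDiffNogoods n d) A (rangeLit v i i false)) :
    UPConflict (allDiffNogoods n d) A := by
  have h1 := derived_prefix_false hd (m := d - 1) (by omega) fun i hi _ => h i hi (by omega)
  have h2 := derived_right_true hd le_rfl le_rfl (h d hd le_rfl) h1
  exact Or.inr ⟨_, h2, derived_empty_right hd v⟩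

end Bounds

/-! ### Propagation of the counters -/

section Counters

variable {n d : ℕ} {A : List (Lit (EncVar n))} {l u : ℕ}

/-- The literal of the atom `ctr i j` of the cardinality rule of `[l, u]`. -/
def ctrLit (n l u i j : ℕ) (b : Bool) : Lit (EncVar n) := ⟨.atom (.ctr (hallRule n l u) i j), b⟩

/-- Once the constraint is to hold, no interval may get more variables than it has values. -/
theorem derived_ctr_bound_false (hl : 1 ≤ l) (hlu : l ≤ u) (hu : u ≤ d)
    (hsat : Derived (allDiffNogoods n d) A ⟨.atom (.base .sat), true⟩) :
    Derived (allDiffNogoods n d) A (ctrLit n l u 0 (u - l + 2) false) := by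
  have h1 := derived_body_of_unique (mem_normal_iff.2 (IsRule.sat (n := n) (d := d))) rfl
    (fun q hq hqa => by
      have hq := mem_normal_iff.1 hq
      cases hq with
      | sat => rfl
      | _ => simp at hqa) hsat
  have h2 := derived_of_body_true (l := ⟨.base .violate, false⟩)
    (mem_normal_iff.2 (IsRule.sat (n := n) (d := d))) (by simp) h1
  have hr := mem_normal_iff.2 (IsRule.hall (n := n) l u hl hlu hu)
  exact derived_of_body_false (l := ⟨.ctr (hallRule n l u) 0 (u - l + 2), true⟩) hr (by simp)
    (derived_body_false_of_head hr rfl h2) fun m hm hne => absurd (List.mem_singleton.1 hm) hne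

/-- The number of elements of `S` from position `i` on. -/
def countFrom (S : Finset (Fin n)) (i : ℕ) : ℕ := (S.filter (fun v => i ≤ v.val)).card

theorem countFrom_self (S : Finset (Fin n)) : countFrom S n = 0 := by
  rw [countFrom, Finset.card_eq_zero, Finset.filter_eq_empty_iff]
  intro v _
  have := v.2
  omega

theorem countFrom_zero (S : Finset (Fin n)) : countFrom S 0 = S.card := by
  simp [countFrom]

theorem countFrom_val (S : Finset (Fin n)) (v : Fin n) :
    countFrom S v = countFrom S (v + 1) + if v ∈ S then 1 else 0 := by
  have h : ∀ w : Fin n, v.val ≤ w.val ↔ w = v ∨ v.val + 1 ≤ w.val := fun w => by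
    rw [Fin.ext_iff]; omega
  simp only [countFrom, h, Finset.filter_or, Finset.filter_eq']
  split_ifs with hv
  · rw [Finset.card_union_of_disjoint, Finset.card_singleton, add_comm]
    rw [Finset.disjoint_singleton_left]
    simp
  · simp

/-- The counters count the elements known to hold. -/
theorem derived_ctr_true (hl : 1 ≤ l) (hlu : l ≤ u) (hu : u ≤ d) {S : Finset (Fin n)}
    (hS : ∀ v ∈ S, Derived (allDiffNogoods n d) A (rangeLit v l u true)) {i : ℕ} (hi : i ≤ n) :
    ∀ j, j ≤ u - l + 2 → j ≤ countFrom S i →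
      Derived (allDiffNogoods n d) A (ctrLit n l u i j true) := by
  induction hi using Nat.decreasingInduction with
  | self =>
    intro j _ hj
    rw [countFrom_self, Nat.le_zero] at hj
    subst hj
    have hr := mem_normal_iff.2 (IsRule.ctr_zero (n := n) l u hl hlu hu)
    exact derived_head hr rfl (derived_body_true hr (by simp))
  | of_succ i hi ih =>
    intro j hjk hj
    have h1 : countFrom S i = _ := countFrom_val S ⟨i, hi⟩
    by_cases hji : j ≤ countFrom S (i + 1)
    · have hr := mem_normal_iff.2 (IsRule.ctr_skip l u hl hlu hu ⟨i, hi⟩ j hjk)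
      refine derived_head hr rfl (derived_body_true hr fun m hm => ?_)
      rw [List.mem_singleton.1 hm]
      exact ih j hjk hji
    · rw [h1] at hj
      split_ifs at hj with hiS
      · obtain ⟨j, rfl⟩ : ∃ k, j = k + 1 := ⟨j - 1, by omega⟩
        have hr := mem_normal_iff.2 (IsRule.ctr_succ l u hl hlu hu ⟨i, hi⟩ j hjk)
        have h2 := ih j (by omega) (by simpa using hj)
        have h3 := hS _ hiS
        exact derived_head hr rfl (derived_body_true hr (by simpa using ⟨h2, h3⟩))
      · exact absurd (by simpa using hj) hji

/-- The elements known to hold before position `i` lower the number allowed from there on. -/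
theorem derived_ctr_false (hl : 1 ≤ l) (hlu : l ≤ u) (hu : u ≤ d) {S : Finset (Fin n)}
    (hsat : Derived (allDiffNogoods n d) A ⟨.atom (.base .sat), true⟩)
    (hS : ∀ v ∈ S, Derived (allDiffNogoods n d) A (rangeLit v l u true)) {i : ℕ} (hi : i ≤ n) :
    ∀ j, j + S.card = u - l + 2 + countFrom S i →
      Derived (allDiffNogoods n d) A (ctrLit n l u i j false) := by
  induction i with
  | zero =>
    intro j hj
    rw [countFrom_zero] at hj
    rw [show j = u - l + 2 by omega]
    exact derived_ctr_bound_false hl hlu hu hsat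
  | succ i ih =>
    intro j hj
    have hi' : i < n := hi
    have h1 : countFrom S i = _ := countFrom_val S ⟨i, hi'⟩
    have hle : countFrom S i ≤ S.card := Finset.card_filter_le _ _
    split_ifs at h1 with hiS
    · have h2 := ih (by omega) (j + 1) (by simp only at h1; omega)
      simp only at h1
      have hr := mem_normal_iff.2 (IsRule.ctr_succ l u hl hlu hu ⟨i, hi'⟩ j (by omega))
      refine derived_of_body_false (l := ⟨.ctr (hallRule n l u) (i + 1) j, true⟩) hr (by simp)
        (derived_body_false_of_head hr rfl h2) fun m hm hne => ?_
      simp only [List.mem_cons, List.not_mem_nil, or_false] at hm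
      rw [hm.resolve_left hne]
      exact hS _ hiS
    · simp only [add_zero] at h1
      have h2 := ih (by omega) j (by omega)
      have hr := mem_normal_iff.2 (IsRule.ctr_skip l u hl hlu hu ⟨i, hi'⟩ j (by omega))
      exact derived_of_body_false (l := ⟨.ctr (hallRule n l u) (i + 1) j, true⟩) hr (by simp)
        (derived_body_false_of_head hr rfl h2)
        fun m hm hne => absurd (List.mem_singleton.1 hm) hne

/-- More variables than values in an interval: conflict. -/
theorem conflict_of_overfull (hl : 1 ≤ l) (hlu : l ≤ u) (hu : u ≤ d) {S : Finset (Fin n)}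
    (hsat : Derived (allDiffNogoods n d) A ⟨.atom (.base .sat), true⟩)
    (hS : ∀ v ∈ S, Derived (allDiffNogoods n d) A (rangeLit v l u true))
    (hcard : u - l + 2 ≤ S.card) : UPConflict (allDiffNogoods n d) A :=
  Or.inr ⟨_, derived_ctr_true hl hlu hu hS (Nat.zero_le n) (u - l + 2) le_rfl
    (by rwa [countFrom_zero]), derived_ctr_bound_false hl hlu hu hsat⟩

/-- A Hall interval is closed to all other variables. -/
theorem derived_false_of_hall (hl : 1 ≤ l) (hlu : l ≤ u) (hu : u ≤ d) {S : Finset (Fin n)}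
    (hsat : Derived (allDiffNogoods n d) A ⟨.atom (.base .sat), true⟩)
    (hS : ∀ v ∈ S, Derived (allDiffNogoods n d) A (rangeLit v l u true))
    (hcard : S.card = u - l + 1) {w : Fin n} (hw : w ∉ S) :
    Derived (allDiffNogoods n d) A (rangeLit w l u false) := by
  have h1 := countFrom_val S w
  rw [if_neg hw, add_zero] at h1
  have hle : countFrom S w ≤ S.card := Finset.card_filter_le _ _
  have h2 := derived_ctr_false hl hlu hu hsat hS w.2.le (countFrom S w + 1) (by omega)
  have h3 := derived_ctr_true hl hlu hu hS w.2 (countFrom S w) (by omega) h1.le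
  have hr := mem_normal_iff.2 (IsRule.ctr_succ l u hl hlu hu w (countFrom S w) (by omega))
  refine derived_of_body_false (l := ⟨.base (.r w l u), true⟩) hr (by simp)
    (derived_body_false_of_head hr rfl h2) fun m hm hne => ?_
  simp only [List.mem_cons, List.not_mem_nil, or_false] at hm
  rw [hm.resolve_right hne]
  exact h3

end Counters
/-! ### Closed sets of literals from families of models -/

section Models

variable {V : Type}

/-- No literal outside `L` is derived from `δ` and literals in `L`. -/
def ClosedUnder (L : Lit V → Prop) (δ : Nogood V) : Prop :=
  ∀ l ∈ δ, (∀ m ∈ δ, m ≠ l → L m) → L l.compl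

theorem ClosedUnder.derived {N : List (Nogood V)} {A : List (Lit V)} {L : Lit V → Prop}
    (hN : ∀ δ ∈ N, ClosedUnder L δ) (hA : ∀ l ∈ A, L l) {l : Lit V} (h : Derived N A l) : L l := by
  induction h with
  | base l h => exact hA l h
  | unit δ hδ l hl _ ih => exact hN δ hδ l hl ih

/-- If the literals over a nogood that are in `L` are those true in all models of a family, and
none of these models violates the nogood, then unit-propagation on it does not leave `L`. Different
nogoods may have different families. -/
theorem closedUnder_of_family {L : Lit V → Prop} {δ : Nogood V} {F : Set (V → Bool)}
    (hL : ∀ x ∈ δ, ∀ s, L ⟨x.var, s⟩ ↔ ∀ M ∈ F, M x.var = s)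
    (hF : ∀ M ∈ F, ∃ l ∈ δ, M l.var ≠ l.sign) : ClosedUnder L δ := by
  intro l hl h
  refine (hL l hl _).2 fun M hM => ?_
  obtain ⟨m, hm, hne⟩ := hF M hM
  by_cases hml : m = l
  · subst hml
    exact Bool.eq_not.2 hne
  · exact absurd ((hL m hm m.sign).1 (h m hm hml) M hM) hne

variable {α : Type}

/-- The truth value of an atom or a body in an interpretation of the atoms. -/
def evalVar (M : α → Bool) : NVar α → Bool
  | .atom a => M a
  | .body b => b.all fun l => M l.var == l.sign

theorem evalVar_body {M : α → Bool} {b : List (Lit α)} :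
    evalVar M (.body b) = true ↔ ∀ l ∈ b, M l.var = l.sign := by
  simp [evalVar]

theorem exists_false_of_mem_nogoods {M : α → Bool} {r : Rule α}
    (hM : evalVar M (.body r.body) = true → ∃ a, r.head = some a ∧ M a = true)
    {δ : Nogood (NVar α)} (hδ : δ ∈ r.nogoods) : ∃ l ∈ δ, evalVar M l.var ≠ l.sign := by
  rcases List.mem_cons.1 hδ with rfl | hδ
  · rcases hb : evalVar M (.body r.body) with _ | _
    · rw [← Bool.not_eq_true, evalVar_body] at hb
      push Not at hb
      obtain ⟨l, hl, h⟩ := hb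
      exact ⟨l.map .atom, List.mem_cons_of_mem _ (List.mem_map.2 ⟨l, hl, rfl⟩), h⟩
    · exact ⟨_, List.mem_cons_self, by simp [hb]⟩
  · rcases List.mem_cons.1 hδ with rfl | hδ
    · rcases hb : evalVar M (.body r.body) with _ | _
      · refine ⟨⟨.body r.body, true⟩, ?_, by simp [hb]⟩
        split <;> simp
      · obtain ⟨a, ha, h⟩ := hM hb
        exact ⟨⟨.atom a, false⟩, by simp [ha], by simp [evalVar, h]⟩
    · obtain ⟨l, hl, rfl⟩ := List.mem_map.1 hδ
      rcases hb : evalVar M (.body r.body) with _ | _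
      · exact ⟨⟨.body r.body, true⟩, by simp, by simp [hb]⟩
      · have h := evalVar_body.1 hb l hl
        exact ⟨(l.map .atom).compl, by simp, by simp [Lit.compl, Lit.map, evalVar, h]⟩

theorem var_of_mem_nogoods {r : Rule α} {δ : Nogood (NVar α)} (hδ : δ ∈ r.nogoods)
    {x : Lit (NVar α)} (hx : x ∈ δ) : x.var = .body r.body ∨ (∃ l ∈ r.body, x.var = .atom l.var) ∨
      ∃ a, r.head = some a ∧ x.var = .atom a := by
  rcases List.mem_cons.1 hδ with rfl | hδ
  · rcases List.mem_cons.1 hx with rfl | hx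
    · exact Or.inl rfl
    · obtain ⟨l, hl, rfl⟩ := List.mem_map.1 hx
      exact Or.inr (Or.inl ⟨l, hl, rfl⟩)
  · rcases List.mem_cons.1 hδ with rfl | hδ
    · split at hx
      · rename_i a ha
        rcases List.mem_cons.1 hx with rfl | hx
        · exact Or.inr (Or.inr ⟨a, ha, rfl⟩)
        · rw [List.mem_singleton.1 hx]; exact Or.inl rfl
      · rw [List.mem_singleton.1 hx]; exact Or.inl rfl
    · obtain ⟨l, hl, rfl⟩ := List.mem_map.1 hδ
      rcases List.mem_cons.1 hx with rfl | hx
      · exact Or.inl rfl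
      · rw [List.mem_singleton.1 hx]; exact Or.inr (Or.inl ⟨l, hl, rfl⟩)

end Models

/-! ### Range consistent domains are never left by unit-propagation -/

section Soundness

variable {n : ℕ}

/-- The parts of the encoding: the ranges of one variable, the counter of one interval, and the
reification of the constraint. -/
inductive Part (n : ℕ)
  | range (v : Fin n) : Part n
  | counter (ρ : CardRule (Atom n)) : Part n
  | reify : Part n

/-- The part to which an atom belongs; the atoms `r v l u` are assigned to their variable although
the counters use them too. -/
def partOfAtom : CAtom (Atom n) → Part n
  | .base (.r v _ _) => .range v
  | .base .sat => .reify
  | .base .violate => .reify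
  | .ctr ρ _ _ => .counter ρ

/-- The part of an atom or body. A nonempty body belongs to the part of its first atom. -/
def partOf : EncVar n → Part n
  | .atom a => partOfAtom a
  | .body [] => .reify
  | .body (l :: _) => partOfAtom l.var

/-- The interpretation of the ranges of a variable that takes the value `i`. -/
def valueModel (n d i : ℕ) : CAtom (Atom n) → Bool
  | .base (.r _ l u) => decide (1 ≤ l ∧ l ≤ i ∧ i ≤ u ∧ u ≤ d)
  | _ => false

/-- The interpretation of a counter when its elements in `B` hold. -/
def countModel (B : Finset (Fin n)) : CAtom (Atom n) → Bool
  | .base (.r v _ _) => decide (v ∈ B)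
  | .base .sat => true
  | .base .violate => false
  | .ctr ρ i j => decide (i ≤ n ∧ j ≤ ρ.bound ∧ j ≤ countFrom B i)

/-- The sets of variables that may be those with a value in `[l, u]`, judged by the domains `E`
one by one and by the number of values. -/
structure Admissible (E : Fin n → Finset ℕ) (l u : ℕ) (B : Finset (Fin n)) : Prop where
  mem_of_subset : ∀ v, E v ⊆ Finset.Icc l u → v ∈ B
  not_disjoint : ∀ v ∈ B, ¬ Disjoint (E v) (Finset.Icc l u)
  card_le : B.card ≤ u - l + 1

/-- The models considered for each part: all values in the domain of a variable, and all
admissible sets for an interval. -/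
def family (d : ℕ) (E : Fin n → Finset ℕ) : Part n → Set (CAtom (Atom n) → Bool)
  | .range v => {M | ∃ i ∈ E v, M = valueModel n d i}
  | .counter ρ => {M | ∃ B, (∀ l u, ρ = hallRule n l u → Admissible E l u B) ∧ M = countModel B}
  | .reify => {countModel ∅}

/-- The literals that are true in all models of their part. -/
def Entailed (d : ℕ) (E : Fin n → Finset ℕ) (x : Lit (EncVar n)) : Prop :=
  ∀ M ∈ family d E (partOf x.var), evalVar M x.var = x.sign

/-- The variable `y` is entailed or refuted by the part `c` exactly if it is by its own part. -/
def Agrees (d : ℕ) (E : Fin n → Finset ℕ) (c : Part n) (y : EncVar n) : Prop :=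
  ∀ s, Entailed d E ⟨y, s⟩ ↔ ∀ M ∈ family d E c, evalVar M y = s

theorem agrees_partOf (d : ℕ) (E : Fin n → Finset ℕ) (y : EncVar n) :
    Agrees d E (partOf y) y := fun _ => Iff.rfl

theorem hallRule_injective (v : Fin n) {l u l' u' : ℕ} (h : hallRule n l u = hallRule n l' u') :
    l = l' ∧ u = u' := by
  have h1 : (hallRule n l u).elems[v.val]? = some ⟨.r v l u, true⟩ :=
    getElem?_elems_hallRule.2 ⟨v, rfl, rfl⟩
  rw [h] at h1
  obtain ⟨w, -, hw⟩ := getElem?_elems_hallRule.1 h1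
  simp only [Lit.mk.injEq, Atom.r.injEq] at hw
  exact hw.1.2

/-- By Hall's argument, a range consistent family of domains leaves room in `[l, u]` for any
variable that may take a value there besides those that must. -/
theorem RangeConsistent.card_insert_le {E : Fin n → Finset ℕ}
    (hE : RangeConsistent (AllDifferent n) E) {l u i : ℕ} {w : Fin n} (hi : i ∈ E w)
    (hl : l ≤ i) (hu : i ≤ u) :
    (insert w (Finset.univ.filter fun v => E v ⊆ Finset.Icc l u)).card ≤ u - l + 1 := by
  obtain ⟨a, ha, haw, hother⟩ := hE w i hi
  have h := Finset.card_le_card_of_injOn (t := Finset.Icc l u) a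
    (s := insert w (Finset.univ.filter fun v => E v ⊆ Finset.Icc l u)) (fun v hv => ?_)
    (fun x _ y _ hxy => ha hxy)
  · rw [Nat.card_Icc] at h
    omega
  · by_cases hvw : v = w
    · rw [hvw, haw]
      exact Finset.mem_coe.2 (Finset.mem_Icc.2 ⟨hl, hu⟩)
    · have hv : E v ⊆ Finset.Icc l u := by
        simpa [hvw] using hv
      obtain ⟨lo, hlo, hi', hhi, h1, h2⟩ := hother v hvw
      have h3 := Finset.mem_Icc.1 (hv hlo)
      have h4 := Finset.mem_Icc.1 (hv hhi)
      exact Finset.mem_coe.2 (Finset.mem_Icc.2 ⟨h3.1.trans h1, h2.trans h4.2⟩)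

variable {d : ℕ} {E : Fin n → Finset ℕ}

theorem RangeConsistent.admissible_insert (hE : RangeConsistent (AllDifferent n) E)
    (hne : ∀ v, (E v).Nonempty) {l u : ℕ} {w : Fin n} (h : ¬ Disjoint (E w) (Finset.Icc l u)) :
    Admissible E l u (insert w (Finset.univ.filter fun v => E v ⊆ Finset.Icc l u)) where
  mem_of_subset := fun v hv => by simp [hv]
  not_disjoint := fun v hv => by
    rcases Finset.mem_insert.1 hv with rfl | hv
    · exact h
    · have hv : E v ⊆ Finset.Icc l u := by simpa using hv
      obtain ⟨i, hi⟩ := hne v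
      exact Finset.not_disjoint_iff.2 ⟨i, hi, hv hi⟩
  card_le := by
    obtain ⟨i, hi, hi'⟩ := Finset.not_disjoint_iff.1 h
    exact hE.card_insert_le hi (Finset.mem_Icc.1 hi').1 (Finset.mem_Icc.1 hi').2

theorem RangeConsistent.admissible (hE : RangeConsistent (AllDifferent n) E)
    (hne : ∀ v, (E v).Nonempty) (l u : ℕ) :
    Admissible E l u (Finset.univ.filter fun v => E v ⊆ Finset.Icc l u) := by
  by_cases h : ∃ w, E w ⊆ Finset.Icc l u
  · obtain ⟨w, hw⟩ := h
    obtain ⟨i, hi⟩ := hne w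
    have := hE.admissible_insert hne (Finset.not_disjoint_iff.2 ⟨i, hi, hw hi⟩)
    rwa [Finset.insert_eq_of_mem (by simp [hw])] at this
  · have : (Finset.univ.filter fun v => E v ⊆ Finset.Icc l u) = ∅ :=
      Finset.filter_eq_empty_iff.2 fun v _ hv => h ⟨v, hv⟩
    rw [this]
    exact ⟨fun v hv => absurd ⟨v, hv⟩ h, by simp, by simp⟩

theorem family_nonempty (hE : RangeConsistent (AllDifferent n) E) (hne : ∀ v, (E v).Nonempty)
    (c : Part n) : (family d E c).Nonempty := by
  cases c with
  | range v =>
    obtain ⟨i, hi⟩ := hne v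
    exact ⟨_, i, hi, rfl⟩
  | counter ρ =>
    by_cases h : ∃ l u, ρ = hallRule n l u
    · obtain ⟨l, u, rfl⟩ := h
      refine ⟨_, Finset.univ.filter fun v => E v ⊆ Finset.Icc l u, fun l' u' h' => ?_, rfl⟩
      by_cases hn : Nonempty (Fin n)
      · obtain ⟨v⟩ := hn
        obtain ⟨rfl, rfl⟩ := hallRule_injective v h'
        exact hE.admissible hne _ _
      · exact ⟨fun v => absurd ⟨v⟩ hn, fun v => absurd ⟨v⟩ hn, by
          rw [Finset.card_eq_zero.2 (Finset.eq_empty_of_forall_notMem fun v => absurd ⟨v⟩ hn)]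
          omega⟩
    · exact ⟨_, ∅, fun l u h' => absurd ⟨l, u, h'⟩ h, rfl⟩
  | reify => exact ⟨_, rfl⟩

theorem entailed_consistent (hE : RangeConsistent (AllDifferent n) E) (hne : ∀ v, (E v).Nonempty)
    {x : Lit (EncVar n)} (h : Entailed d E x) : ¬ Entailed d E x.compl := by
  intro h'
  obtain ⟨M, hM⟩ := family_nonempty (d := d) hE hne (partOf x.var)
  have h1 := h M hM
  have h2 : evalVar M x.var = !x.sign := h' M hM
  rw [h1] at h2
  simp at h2

theorem entailed_rangeLit_iff {v : Fin n} {l u : ℕ} (hl : 1 ≤ l) (hu : u ≤ d) (b : Bool) :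
    Entailed d E (rangeLit v l u b) ↔ ∀ i ∈ E v, (i ∈ Finset.Icc l u ↔ b) := by
  have : Entailed d E (rangeLit v l u b) ↔
      ∀ i ∈ E v, decide (1 ≤ l ∧ l ≤ i ∧ i ≤ u ∧ u ≤ d) = b := by
    constructor
    · exact fun h i hi => h _ ⟨i, hi, rfl⟩
    · rintro h _ ⟨i, hi, rfl⟩
      exact h i hi
  rw [this]
  refine forall₂_congr fun i _ => ?_
  rw [Finset.mem_Icc]
  cases b <;> simp [hl, hu]

theorem agrees_counter_r (hE : RangeConsistent (AllDifferent n) E) (hne : ∀ v, (E v).Nonempty)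
    {v : Fin n} {l u : ℕ} (hl : 1 ≤ l) (hu : u ≤ d) :
    Agrees d E (.counter (hallRule n l u)) (.atom (.base (.r v l u))) := by
  have hfam : ∀ {B}, Admissible E l u B →
      countModel B ∈ family d E (.counter (hallRule n l u)) := by
    intro B hB
    refine ⟨B, fun l' u' h => ?_, rfl⟩
    obtain ⟨rfl, rfl⟩ := hallRule_injective v h
    exact hB
  intro s
  refine (entailed_rangeLit_iff hl hu s).trans ⟨?_, fun h => ?_⟩
  · rintro h _ ⟨B, hB, rfl⟩
    have hB := hB l u rfl
    cases s with
    | true =>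
      have := hB.mem_of_subset v fun i hi => (h i hi).2 rfl
      simpa [evalVar, countModel] using this
    | false =>
      have : v ∉ B := fun hv => hB.not_disjoint v hv <| Finset.disjoint_left.2 fun i hi hi' => by
        simpa using (h i hi).1 hi'
      simpa [evalVar, countModel] using this
  · cases s with
    | true =>
      have := h _ (hfam (hE.admissible hne l u))
      have : E v ⊆ Finset.Icc l u := by simpa [evalVar, countModel] using this
      intro i hi
      simp [this hi]
    | false =>
      by_cases hd : Disjoint (E v) (Finset.Icc l u)
      · intro i hi
        simp [Finset.disjoint_left.1 hd hi]
      · have := h _ (hfam (hE.admissible_insert hne hd))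
        simp [evalVar, countModel] at this

/-- A variable that has the same value in all models belongs to all parts. -/
theorem agrees_of_const (hE : RangeConsistent (AllDifferent n) E) (hne : ∀ v, (E v).Nonempty)
    {c : Part n} {y : EncVar n} {b : Bool} (h : ∀ M ∈ family d E (partOf y), evalVar M y = b)
    (h' : ∀ M ∈ family d E c, evalVar M y = b) : Agrees d E c y := by
  intro s
  obtain ⟨M, hM⟩ := family_nonempty (d := d) hE hne (partOf y)
  obtain ⟨M', hM'⟩ := family_nonempty (d := d) hE hne c
  constructor
  · intro hs K hK
    rw [h' K hK, ← h M hM]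
    exact hs M hM
  · intro hs K hK
    have h1 : b = s := (h' M' hM').symm.trans (hs M' hM')
    exact (h K hK).trans h1

theorem agrees_body_nil (hE : RangeConsistent (AllDifferent n) E) (hne : ∀ v, (E v).Nonempty)
    (c : Part n) : Agrees d E c (.body []) :=
  agrees_of_const hE hne (b := true) (fun _ _ => rfl) fun _ _ => rfl

theorem closedUnder_nogood_rule {c : Part n} {r : Rule (CAtom (Atom n))}
    (hb : Agrees d E c (.body r.body)) (hl : ∀ l ∈ r.body, Agrees d E c (.atom l.var))
    (hh : ∀ a, r.head = some a → Agrees d E c (.atom a))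
    (hM : ∀ M ∈ family d E c, (∀ l ∈ r.body, M l.var = l.sign) → ∃ a, r.head = some a ∧ M a = true)
    {δ : Nogood (EncVar n)} (hδ : δ ∈ r.nogoods) : ClosedUnder (Entailed d E) δ := by
  refine closedUnder_of_family (F := evalVar '' family d E c) (fun x hx s => ?_) ?_
  · rw [Set.forall_mem_image]
    rcases var_of_mem_nogoods hδ hx with h | ⟨l, h, h'⟩ | ⟨a, h, h'⟩
    · rw [h]; exact hb s
    · rw [h']; exact hl l h s
    · rw [h']; exact hh a h s
  · rw [Set.forall_mem_image]
    exact fun M hMc => exists_false_of_mem_nogoods (fun h => hM M hMc (evalVar_body.1 h)) hδ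

theorem closedUnder_supportNogood {c : Part n} {P : List (Rule (CAtom (Atom n)))}
    {a : CAtom (Atom n)} (ha : Agrees d E c (.atom a))
    (hr : ∀ r ∈ P, r.head = some a → Agrees d E c (.body r.body))
    (hM : ∀ M ∈ family d E c, M a = true →
      ∃ r ∈ P, r.head = some a ∧ ∀ l ∈ r.body, M l.var = l.sign) :
    ClosedUnder (Entailed d E) (supportNogood P a) := by
  refine closedUnder_of_family (F := evalVar '' family d E c) (fun x hx s => ?_) ?_
  · rw [Set.forall_mem_image]
    rcases mem_supportNogood.1 hx with rfl | ⟨r, hrP, hra, rfl⟩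
    · exact ha s
    · exact hr r hrP hra s
  · rw [Set.forall_mem_image]
    intro M hMc
    rcases hMa : M a with _ | _
    · exact ⟨_, mem_supportNogood.2 (Or.inl rfl), by simp [evalVar, hMa]⟩
    · obtain ⟨r, hrP, hra, h⟩ := hM M hMc hMa
      exact ⟨_, mem_supportNogood.2 (Or.inr ⟨r, hrP, hra, rfl⟩), by simp [evalVar_body.2 h]⟩

theorem closedUnder_rule (hE : RangeConsistent (AllDifferent n) E) (hne : ∀ v, (E v).Nonempty)
    (hEd : ∀ v, E v ⊆ Finset.Icc 1 d) {r : Rule (CAtom (Atom n))} (hr : IsRule n d r)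
    {δ : Nogood (EncVar n)} (hδ : δ ∈ r.nogoods) : ClosedUnder (Entailed d E) δ := by
  cases hr with
  | range v l u hl hlu hu =>
    refine closedUnder_nogood_rule (c := .range v) (agrees_partOf _ _ _) ?_ ?_ ?_ hδ
    · simp only [List.mem_cons, List.not_mem_nil, or_false, forall_eq_or_imp, forall_eq]
      exact ⟨agrees_partOf _ _ _, agrees_partOf _ _ _⟩
    · rintro _ ⟨⟩; exact agrees_partOf _ _ _
    · rintro _ ⟨i, hi, rfl⟩ hb
      have := Finset.mem_Icc.1 (hEd v hi)
      simp [valueModel] at hb ⊢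
      omega
  | left v l u hl hlu hu =>
    refine closedUnder_nogood_rule (c := .range v) (agrees_partOf _ _ _) ?_ (by simp) ?_ hδ
    · simp only [List.mem_cons, List.not_mem_nil, or_false, forall_eq_or_imp, forall_eq]
      exact ⟨agrees_partOf _ _ _, agrees_partOf _ _ _⟩
    · rintro _ ⟨i, hi, rfl⟩ hb
      simp [valueModel] at hb
      omega
  | right v l u hl hlu hu =>
    refine closedUnder_nogood_rule (c := .range v) (agrees_partOf _ _ _) ?_ (by simp) ?_ hδ
    · simp only [List.mem_cons, List.not_mem_nil, or_false, forall_eq_or_imp, forall_eq]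
      exact ⟨agrees_partOf _ _ _, agrees_partOf _ _ _⟩
    · rintro _ ⟨i, hi, rfl⟩ hb
      simp [valueModel] at hb
      omega
  | sat =>
    refine closedUnder_nogood_rule (c := .reify) (agrees_partOf _ _ _) ?_ ?_ ?_ hδ
    · simp only [List.mem_singleton, forall_eq]; exact agrees_partOf _ _ _
    · rintro _ ⟨⟩; exact agrees_partOf _ _ _
    · rintro _ rfl -; exact ⟨_, rfl, rfl⟩
  | violate =>
    refine closedUnder_nogood_rule (c := .reify) (agrees_partOf _ _ _) ?_ ?_ ?_ hδ
    · simp only [List.mem_singleton, forall_eq]; exact agrees_partOf _ _ _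
    · rintro _ ⟨⟩; exact agrees_partOf _ _ _
    · rintro _ rfl hb; simp [countModel] at hb
  | hall l u hl hlu hu =>
    refine closedUnder_nogood_rule (c := .counter (hallRule n l u)) (agrees_partOf _ _ _)
      ?_ ?_ ?_ hδ
    · simp only [List.mem_singleton, forall_eq]; exact agrees_partOf _ _ _
    · rintro _ ⟨⟩
      refine agrees_of_const hE hne (b := false) ?_ ?_
      · rintro _ rfl; rfl
      · rintro _ ⟨B, -, rfl⟩; rfl
    · rintro _ ⟨B, hB, rfl⟩ hb
      have h1 := (hB l u rfl).card_le
      simp [countModel, countFrom_zero] at hb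
      omega
  | ctr_zero l u hl hlu hu =>
    refine closedUnder_nogood_rule (c := .counter (hallRule n l u)) (agrees_body_nil hE hne _)
      (by simp) ?_ ?_ hδ
    · rintro _ ⟨⟩; exact agrees_partOf _ _ _
    · rintro _ ⟨B, hB, rfl⟩ hb
      exact ⟨_, rfl, by simp [countModel]⟩
  | ctr_skip l u hl hlu hu v j hj =>
    refine closedUnder_nogood_rule (c := .counter (hallRule n l u)) (agrees_partOf _ _ _)
      ?_ ?_ ?_ hδ
    · simp only [List.mem_singleton, forall_eq]; exact agrees_partOf _ _ _
    · rintro _ ⟨⟩; exact agrees_partOf _ _ _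
    · rintro _ ⟨B, hB, rfl⟩ hb
      have h1 := countFrom_val B v
      simp [countModel] at hb ⊢
      omega
  | ctr_succ l u hl hlu hu v j hj =>
    refine closedUnder_nogood_rule (c := .counter (hallRule n l u)) (agrees_partOf _ _ _)
      ?_ ?_ ?_ hδ
    · simp only [List.mem_cons, List.not_mem_nil, or_false, forall_eq_or_imp, forall_eq]
      exact ⟨agrees_partOf _ _ _, agrees_counter_r hE hne hl hu⟩
    · rintro _ ⟨⟩; exact agrees_partOf _ _ _
    · rintro _ ⟨B, hB, rfl⟩ hb
      have h1 := countFrom_val B v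
      simp [countModel, hallRule] at hb ⊢
      rw [if_pos hb.2] at h1
      omega

theorem exists_hallRule_of_mem_atomsOf {d : ℕ} {ρ : CardRule (Atom n)} {i j : ℕ}
    (h : CAtom.ctr ρ i j ∈ atomsOf (allDiffProgram n d).normal) :
    ∃ l u, 1 ≤ l ∧ l ≤ u ∧ u ≤ d ∧ ρ = hallRule n l u := by
  obtain ⟨r, hr, h⟩ := List.mem_flatMap.1 (List.mem_dedup.1 h)
  have hr := mem_normal_iff.1 hr
  cases hr with
  | hall l u hl hlu hu =>
    refine ⟨l, u, hl, hlu, hu, ?_⟩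
    simp at h
    tauto
  | ctr_zero l u hl hlu hu =>
    refine ⟨l, u, hl, hlu, hu, ?_⟩
    simp at h
    tauto
  | ctr_skip l u hl hlu hu v j hj =>
    refine ⟨l, u, hl, hlu, hu, ?_⟩
    simp at h
    tauto
  | ctr_succ l u hl hlu hu v j hj =>
    refine ⟨l, u, hl, hlu, hu, ?_⟩
    simp at h
    tauto
  | _ => simp at h

theorem closedUnder_support (hE : RangeConsistent (AllDifferent n) E)
    (hne : ∀ v, (E v).Nonempty) {a : CAtom (Atom n)}
    (ha : a ∈ atomsOf (allDiffProgram n d).normal) :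
    ClosedUnder (Entailed d E) (supportNogood (allDiffProgram n d).normal a) := by
  rcases a with (⟨v, l, u⟩ | _ | _) | ⟨ρ, i, j⟩
  · refine closedUnder_supportNogood (c := .range v) (agrees_partOf _ _ _) (fun r hr hra => ?_) ?_
    · rw [(head_eq_r hr hra).1]; exact agrees_partOf _ _ _
    · rintro _ ⟨i, hi, rfl⟩ h
      have h : 1 ≤ l ∧ l ≤ i ∧ i ≤ u ∧ u ≤ d := by simpa [valueModel] using h
      refine ⟨_, rangeRule_mem h.1 (h.2.1.trans h.2.2.1) h.2.2.2, rfl, ?_⟩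
      simp [rangeRule, valueModel]
      omega
  · refine closedUnder_supportNogood (c := .reify) (agrees_partOf _ _ _) (fun r hr hra => ?_) ?_
    · have hr := mem_normal_iff.1 hr
      cases hr with
      | sat => exact agrees_partOf _ _ _
      | _ => simp at hra
    · rintro _ rfl -
      exact ⟨_, mem_normal_iff.2 .sat, rfl, by simp [countModel]⟩
  · have hF : Entailed d E ⟨.atom (.base .violate), false⟩ := by rintro _ rfl; rfl
    -- as `T violate` is not entailed, nothing but `F violate` can be derived
    intro l hl h
    by_cases hlv : l = ⟨.atom (.base .violate), true⟩
    · rw [hlv]; exact hF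
    · exact absurd hF (entailed_consistent hE hne
        (h _ (mem_supportNogood.2 (Or.inl rfl)) (Ne.symm hlv)))
  · obtain ⟨l, u, hl, hlu, hu, rfl⟩ := exists_hallRule_of_mem_atomsOf ha
    refine closedUnder_supportNogood (c := .counter (hallRule n l u)) (agrees_partOf _ _ _)
      (fun r hr hra => ?_) ?_
    · have hr := mem_normal_iff.1 hr
      cases hr with
      | ctr_zero l' u' _ _ _ => exact agrees_body_nil hE hne _
      | ctr_skip l' u' _ _ _ v j _ =>
        simp only [Option.some.injEq, CAtom.ctr.injEq] at hra
        rw [← hra.1]; exact agrees_partOf _ _ _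
      | ctr_succ l' u' _ _ _ v j _ =>
        simp only [Option.some.injEq, CAtom.ctr.injEq] at hra
        rw [← hra.1]; exact agrees_partOf _ _ _
      | _ => simp at hra
    · rintro _ ⟨B, hB, rfl⟩ h
      have h : i ≤ n ∧ j ≤ u - l + 2 ∧ j ≤ countFrom B i := of_decide_eq_true h
      rcases h.1.eq_or_lt with rfl | hi
      · have h1 := h.2.2
        rw [countFrom_self, Nat.le_zero] at h1
        subst h1
        exact ⟨_, mem_normal_iff.2 (.ctr_zero l u hl hlu hu), rfl, by simp⟩
      · have h1 : countFrom B i = _ := countFrom_val B ⟨i, hi⟩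
        by_cases hj : j ≤ countFrom B (i + 1)
        · refine ⟨_, mem_normal_iff.2 (.ctr_skip l u hl hlu hu ⟨i, hi⟩ j h.2.1), rfl, ?_⟩
          simp [countModel, hallRule]
          omega
        · by_cases hiB : (⟨i, hi⟩ : Fin n) ∈ B
          · rw [if_pos hiB] at h1
            simp only at h1
            obtain ⟨j, rfl⟩ : ∃ k, j = k + 1 := ⟨j - 1, by omega⟩
            refine ⟨_, mem_normal_iff.2 (.ctr_succ l u hl hlu hu ⟨i, hi⟩ j (by omega)), rfl, ?_⟩
            simp [countModel, hallRule, hiB]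
            omega
          · rw [if_neg hiB] at h1
            simp only at h1
            omega

theorem closedUnder_allDiffNogoods (hE : RangeConsistent (AllDifferent n) E)
    (hne : ∀ v, (E v).Nonempty) (hEd : ∀ v, E v ⊆ Finset.Icc 1 d) :
    ∀ δ ∈ allDiffNogoods n d, ClosedUnder (Entailed d E) δ := by
  intro δ hδ
  obtain ⟨δ', hδ', rfl⟩ := mem_nogoods.1 hδ
  have h : ClosedUnder (Entailed d E) δ' := by
    rcases hδ' with ⟨r, hr, h⟩ | ⟨a, ha, rfl⟩
    · exact closedUnder_rule hE hne hEd (mem_normal_iff.1 hr) h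
    · exact closedUnder_support hE hne ha
  exact fun l hl hm => h l (List.mem_dedup.1 hl) fun m hm' => hm m (List.mem_dedup.2 hm')

theorem ne_nil_of_mem_nogoods {α : Type} [DecidableEq α] {P : List (Rule α)}
    {δ : Nogood (NVar α)} (hδ : δ ∈ nogoods P) : δ ≠ [] := by
  obtain ⟨δ', hδ', rfl⟩ := mem_nogoods.1 hδ
  rw [ne_eq, List.dedup_eq_nil]
  rcases hδ' with ⟨r, hr, h⟩ | ⟨a, ha, rfl⟩
  · rintro rfl
    rcases hh : r.head with _ | a <;> simp [Rule.nogoods, hh] at h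
  · exact List.cons_ne_nil _ _

theorem mem_upDomain {A : List (Lit (EncVar n))} {v : Fin n} {i : ℕ} :
    i ∈ upDomain d A v ↔
      (1 ≤ i ∧ i ≤ d) ∧ ¬ Derived (allDiffNogoods n d) A (rangeLit v i i false) := by
  simp only [upDomain, Finset.mem_filter, Finset.mem_Icc]

theorem mem_nodeDomain {D : Fin n → Finset ℕ} {ds : List (Lit (EncVar n))} {v : Fin n} {i : ℕ} :
    i ∈ nodeDomain D ds v ↔ i ∈ D v ∧
      ∀ (l u : ℕ) (b : Bool), rangeLit v l u b ∈ ds → (i ∈ Finset.Icc l u ↔ b) := by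
  simp only [nodeDomain, Finset.mem_filter]

/-- Unit-propagation from literals that the range consistent domains `E` entail neither fails nor
removes a value from `E`. -/
theorem not_conflict_of_entailed (hE : RangeConsistent (AllDifferent n) E)
    (hne : ∀ v, (E v).Nonempty) (hEd : ∀ v, E v ⊆ Finset.Icc 1 d) {A : List (Lit (EncVar n))}
    (hA : ∀ l ∈ A, Entailed d E l) :
    ¬ UPConflict (allDiffNogoods n d) A ∧ E ≤ upDomain d A := by
  have hD : ∀ l, Derived (allDiffNogoods n d) A l → Entailed d E l := fun l =>
    ClosedUnder.derived (closedUnder_allDiffNogoods hE hne hEd) hA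
  refine ⟨?_, fun v i hi => ?_⟩
  · rintro (⟨δ, hδ, h⟩ | ⟨l, h1, h2⟩)
    · obtain ⟨l, hl⟩ := List.exists_mem_of_ne_nil δ (ne_nil_of_mem_nogoods hδ)
      exact entailed_consistent hE hne (hD l (h l hl))
        (closedUnder_allDiffNogoods hE hne hEd δ hδ l hl fun m hm _ => hD m (h m hm))
    · exact entailed_consistent hE hne (hD _ h1) (hD _ h2)
  · have hi' := Finset.mem_Icc.1 (hEd v hi)
    refine mem_upDomain.2 ⟨hi', fun h => ?_⟩
    have := ((entailed_rangeLit_iff hi'.1 hi'.2 false).1 (hD _ h) i hi).1 (by simp)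
    simp at this

theorem entailed_of_le_nodeDomain {D : Fin n → Finset ℕ} {ds : List (Lit (EncVar n))}
    (hds : ∀ x ∈ ds, ∃ (v : Fin n) (l u : ℕ) (b : Bool),
      1 ≤ l ∧ l ≤ u ∧ u ≤ d ∧ x = rangeLit v l u b)
    (hED : E ≤ nodeDomain D ds) : ∀ x ∈ rootLits d D ++ ds, Entailed d E x := by
  have hmem : ∀ v, ∀ i ∈ E v, i ∈ D v ∧
      ∀ (l u : ℕ) (b : Bool), rangeLit v l u b ∈ ds → (i ∈ Finset.Icc l u ↔ b) := fun v i hi =>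
    mem_nodeDomain.1 (hED v hi)
  intro x hx
  rcases List.mem_append.1 hx with hx | hx
  · rcases List.mem_cons.1 hx with rfl | hx
    · rintro _ rfl; rfl
    · obtain ⟨v, -, hx⟩ := List.mem_flatMap.1 hx
      obtain ⟨i, hi, rfl⟩ := List.mem_map.1 hx
      simp only [List.mem_filter, List.mem_range'_1, decide_eq_true_eq] at hi
      refine (entailed_rangeLit_iff (by omega) (by omega) false).2 fun k hk => ?_
      have hki : k ≠ i := by
        rintro rfl
        exact hi.2 (hmem v k hk).1
      simpa using hki
  · obtain ⟨v, l, u, b, hl, -, hu, rfl⟩ := hds x hx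
    exact (entailed_rangeLit_iff hl hu b).2 fun i hi => (hmem v i hi).2 l u b hx

end Soundness
/-! ### Hall's theorem for intervals -/

/-- If a nonempty family of intervals has fewer values than members, so does the family of those
members that lie in a suitable interval. The family splits at any value it misses. -/
theorem exists_overfull_interval {ι : Type*} [DecidableEq ι] (lo hi : ι → ℕ)
    (hlh : ∀ x, lo x ≤ hi x) (S : Finset ι) :
    (S.biUnion fun x => Finset.Icc (lo x) (hi x)).card < S.card →
    ∃ l u, (∃ x ∈ S, l = lo x) ∧ (∃ x ∈ S, u = hi x) ∧ l ≤ u ∧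
      u - l + 1 < (S.filter fun x => l ≤ lo x ∧ hi x ≤ u).card := by
  induction S using Finset.strongInduction with
  | H S ih =>
  intro hS
  have hne : S.Nonempty := Finset.card_pos.1 (by omega)
  obtain ⟨x, hx, hxmin⟩ := Finset.exists_min_image S lo hne
  obtain ⟨y, hy, hymax⟩ := Finset.exists_max_image S hi hne
  have hxy : lo x ≤ hi y := (hlh x).trans (hymax x hx)
  by_cases hgap : ∃ g, lo x ≤ g ∧ g ≤ hi y ∧ ∀ z ∈ S, ¬ (lo z ≤ g ∧ g ≤ hi z)
  · obtain ⟨g, hg1, hg2, hg⟩ := hgap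
    set L := S.filter fun z => hi z < g with hL
    set R := S.filter fun z => ¬ hi z < g with hR
    have hcard : L.card + R.card = S.card := Finset.card_filter_add_card_filter_not _
    have hxL : x ∈ L := Finset.mem_filter.2 ⟨hx, by have := hg x hx; omega⟩
    have hyR : y ∈ R := Finset.mem_filter.2 ⟨hy, by omega⟩
    have hdisj : Disjoint (L.biUnion fun z => Finset.Icc (lo z) (hi z))
        (R.biUnion fun z => Finset.Icc (lo z) (hi z)) := by
      rw [Finset.disjoint_left]
      intro i h1 h2
      simp only [Finset.mem_biUnion, Finset.mem_Icc, hL, hR, Finset.mem_filter] at h1 h2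
      obtain ⟨z, ⟨-, hz⟩, hzi⟩ := h1
      obtain ⟨w, ⟨hw, hw'⟩, hwi⟩ := h2
      have := hg w hw
      omega
    have hunion : (L.biUnion fun z => Finset.Icc (lo z) (hi z)) ∪
        (R.biUnion fun z => Finset.Icc (lo z) (hi z)) =
        S.biUnion fun z => Finset.Icc (lo z) (hi z) := by
      rw [← Finset.union_biUnion, Finset.filter_union_filter_not_eq]
    rw [← hunion, Finset.card_union_of_disjoint hdisj] at hS
    have step : ∀ T ⊂ S, (T.biUnion fun z => Finset.Icc (lo z) (hi z)).card < T.card →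
        ∃ l u, (∃ x ∈ S, l = lo x) ∧ (∃ x ∈ S, u = hi x) ∧ l ≤ u ∧
          u - l + 1 < (S.filter fun x => l ≤ lo x ∧ hi x ≤ u).card := by
      intro T hT hTc
      obtain ⟨l, u, ⟨a, ha, hl⟩, ⟨b, hb, hu⟩, hlu, h⟩ := ih T hT hTc
      exact ⟨l, u, ⟨a, hT.1 ha, hl⟩, ⟨b, hT.1 hb, hu⟩, hlu, h.trans_le
        (Finset.card_le_card (Finset.filter_subset_filter _ hT.1))⟩
    rcases lt_or_ge (L.biUnion fun z => Finset.Icc (lo z) (hi z)).card L.card with h | h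
    · refine step L (Finset.filter_ssubset.2 ⟨y, hy, by omega⟩) h
    · refine step R (Finset.filter_ssubset.2 ⟨x, hx, ?_⟩) (by omega)
      simpa using (Finset.mem_filter.1 hxL).2
  · push Not at hgap
    refine ⟨lo x, hi y, ⟨x, hx, rfl⟩, ⟨y, hy, rfl⟩, hxy, ?_⟩
    have h1 : (S.filter fun z => lo x ≤ lo z ∧ hi z ≤ hi y) = S :=
      Finset.filter_true_of_mem fun z hz => ⟨hxmin z hz, hymax z hz⟩
    have h2 : Finset.Icc (lo x) (hi y) ⊆ S.biUnion fun z => Finset.Icc (lo z) (hi z) := by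
      intro g hg
      obtain ⟨hg1, hg2⟩ := Finset.mem_Icc.1 hg
      obtain ⟨z, hz, hz1, hz2⟩ := hgap g hg1 hg2
      exact Finset.mem_biUnion.2 ⟨z, hz, Finset.mem_Icc.2 ⟨hz1, hz2⟩⟩
    have h3 := Finset.card_le_card h2
    rw [Nat.card_Icc] at h3
    rw [h1]
    omega

section Consistency

variable {n : ℕ} {E : Fin n → Finset ℕ}

/-- Nonempty domains in which no interval is overfull, and in which the Hall intervals are pruned,
are range consistent. -/
theorem rangeConsistent_of_hall {d : ℕ} (hEd : ∀ v, E v ⊆ Finset.Icc 1 d)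
    (hne : ∀ v, (E v).Nonempty)
    (hcard : ∀ l u, 1 ≤ l → l ≤ u → u ≤ d →
      (Finset.univ.filter fun v => E v ⊆ Finset.Icc l u).card ≤ u - l + 1)
    (hhall : ∀ l u, 1 ≤ l → l ≤ u → u ≤ d →
      (Finset.univ.filter fun v => E v ⊆ Finset.Icc l u).card = u - l + 1 →
      ∀ w, ¬ E w ⊆ Finset.Icc l u → Disjoint (E w) (Finset.Icc l u)) :
    RangeConsistent (AllDifferent n) E := by
  intro v i hi
  -- the hull of each domain, except that `v` is fixed to `i`
  let lo : Fin n → ℕ := fun w => if w = v then i else (E w).min' (hne w)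
  let hi' : Fin n → ℕ := fun w => if w = v then i else (E w).max' (hne w)
  have hloE : ∀ w, lo w ∈ E w := fun w => by
    by_cases h : w = v
    · subst h; simpa [lo] using hi
    · simpa [lo, h] using Finset.min'_mem _ _
  have hhiE : ∀ w, hi' w ∈ E w := fun w => by
    by_cases h : w = v
    · subst h; simpa [hi'] using hi
    · simpa [hi', h] using Finset.max'_mem _ _
  have hlh : ∀ w, lo w ≤ hi' w := fun w => by
    by_cases h : w = v
    · simp [lo, hi', h]
    · simpa [lo, hi', h] using Finset.min'_le_max' _ _
  have hsub : ∀ w, w ≠ v → ∀ l u, l ≤ lo w → hi' w ≤ u → E w ⊆ Finset.Icc l u := by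
    intro w hw l u h1 h2 k hk
    simp only [lo, hi', hw, if_false] at h1 h2
    exact Finset.mem_Icc.2 ⟨h1.trans (Finset.min'_le _ _ hk), (Finset.le_max' _ _ hk).trans h2⟩
  have hHall : ∀ S : Finset (Fin n),
      S.card ≤ (S.biUnion fun w => Finset.Icc (lo w) (hi' w)).card := by
    intro S
    by_contra hS
    obtain ⟨l, u, ⟨x, hx, hl⟩, ⟨y, hy, hu⟩, hlu, hover⟩ :=
      exists_overfull_interval lo hi' hlh S (not_le.1 hS)
    have hl1 : 1 ≤ l := hl ▸ (Finset.mem_Icc.1 (hEd x (hloE x))).1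
    have hud : u ≤ d := hu ▸ (Finset.mem_Icc.1 (hEd y (hhiE y))).2
    have hsubset : (S.filter fun w => l ≤ lo w ∧ hi' w ≤ u) ⊆
        insert v (Finset.univ.filter fun w => E w ⊆ Finset.Icc l u) := by
      intro w hw
      obtain ⟨-, h1, h2⟩ := Finset.mem_filter.1 hw
      by_cases hwv : w = v
      · simp [hwv]
      · simp [hsub w hwv l u h1 h2]
    have h1 := hcard l u hl1 hlu hud
    have h2 := Finset.card_le_card hsubset
    -- the surplus is due to `v`, so its value `i` lies in the Hall interval `[l, u]`
    by_cases hvS : v ∈ S.filter fun w => l ≤ lo w ∧ hi' w ≤ u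
    · have hil : l ≤ i ∧ i ≤ u := by simpa [lo, hi'] using (Finset.mem_filter.1 hvS).2
      by_cases hEv : E v ⊆ Finset.Icc l u
      · rw [Finset.insert_eq_of_mem (by simp [hEv])] at h2
        omega
      · have h3 := Finset.card_insert_le v (Finset.univ.filter fun w => E w ⊆ Finset.Icc l u)
        exact Finset.disjoint_left.1 (hhall l u hl1 hlu hud (by omega) v hEv) hi
          (Finset.mem_Icc.2 hil)
    · have h3 := Finset.card_le_card fun w (hw : w ∈ S.filter fun w => l ≤ lo w ∧ hi' w ≤ u) =>
        (Finset.mem_insert.1 (hsubset hw)).resolve_left fun h => hvS (h ▸ hw)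
      omega
  obtain ⟨a, ha, hmem⟩ := (Finset.all_card_le_biUnion_card_iff_exists_injective _).1 hHall
  refine ⟨a, ha, ?_, fun w _ => ?_⟩
  · have := Finset.mem_Icc.1 (hmem v)
    simp only [lo, hi', if_true] at this
    omega
  · have := Finset.mem_Icc.1 (hmem w)
    exact ⟨lo w, hloE w, hi' w, hhiE w, this.1, this.2⟩

/-- A variable whose domain is not contained in a Hall interval cannot take a value there. -/
theorem RangeConsistent.disjoint_of_hall (hE : RangeConsistent (AllDifferent n) E) {l u : ℕ}
    (hcard : (Finset.univ.filter fun v => E v ⊆ Finset.Icc l u).card = u - l + 1) {w : Fin n}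
    (hw : ¬ E w ⊆ Finset.Icc l u) : Disjoint (E w) (Finset.Icc l u) := by
  rw [Finset.disjoint_left]
  intro i hi hi'
  obtain ⟨h1, h2⟩ := Finset.mem_Icc.1 hi'
  have h3 := hE.card_insert_le hi h1 h2
  rw [Finset.card_insert_of_notMem (by simpa using hw)] at h3
  omega

/-- A range consistent family of domains with an empty member is empty throughout. -/
theorem RangeConsistent.eq_empty {R : Set (Fin n → ℕ)} (hE : RangeConsistent R E) {v : Fin n}
    (hv : E v = ∅) (w : Fin n) : E w = ∅ := by
  by_contra hw
  obtain ⟨i, hi⟩ := Finset.nonempty_iff_ne_empty.2 hw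
  obtain ⟨a, -, -, h⟩ := hE w i hi
  obtain ⟨lo, hlo, -⟩ := h v (by rintro rfl; exact hw hv)
  simp [hv] at hlo

end Consistency

/-! ### Unit-propagation enforces range consistency -/

section Node

variable {n d : ℕ} {D : Fin n → Finset ℕ} {ds : List (Lit (EncVar n))}

theorem upDomain_subset (A : List (Lit (EncVar n))) (v : Fin n) :
    upDomain d A v ⊆ Finset.Icc 1 d := fun _ hi =>
  Finset.mem_Icc.2 (mem_upDomain.1 hi).1

theorem upDomain_nonempty (hd : 1 ≤ d) {A : List (Lit (EncVar n))}
    (hA : ¬ UPConflict (allDiffNogoods n d) A) (v : Fin n) : (upDomain d A v).Nonempty := by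
  by_contra hv
  refine hA (conflict_of_all_excluded hd (v := v) fun i h1 h2 => ?_)
  by_contra hi
  exact hv ⟨i, mem_upDomain.2 ⟨⟨h1, h2⟩, hi⟩⟩

theorem derived_r_true_of_upDomain_subset {A : List (Lit (EncVar n))} {l u : ℕ} (hl : 1 ≤ l)
    (hlu : l ≤ u) (hu : u ≤ d) {v : Fin n} (h : upDomain d A v ⊆ Finset.Icc l u) :
    Derived (allDiffNogoods n d) A (rangeLit v l u true) :=
  derived_r_true_of_outside hl hlu hu fun i h1 h2 h3 => by
    by_contra hi
    exact h3 (Finset.mem_Icc.1 (h (mem_upDomain.2 ⟨⟨h1, h2⟩, hi⟩)))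

theorem rangeConsistent_upDomain (hd : 1 ≤ d) {A : List (Lit (EncVar n))}
    (hA : ¬ UPConflict (allDiffNogoods n d) A)
    (hsat : Derived (allDiffNogoods n d) A ⟨.atom (.base .sat), true⟩) :
    RangeConsistent (AllDifferent n) (upDomain d A) := by
  have hT : ∀ {l u}, 1 ≤ l → l ≤ u → u ≤ d →
      ∀ v ∈ Finset.univ.filter (fun v => upDomain d A v ⊆ Finset.Icc l u),
        Derived (allDiffNogoods n d) A (rangeLit v l u true) := fun hl hlu hu v hv =>
    derived_r_true_of_upDomain_subset hl hlu hu (by simpa using hv)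
  refine rangeConsistent_of_hall (upDomain_subset A) (upDomain_nonempty hd hA)
    (fun l u hl hlu hu => ?_) fun l u hl hlu hu hcard w hw => ?_
  · by_contra h
    exact hA (conflict_of_overfull hl hlu hu hsat (hT hl hlu hu) (by omega))
  · have h := derived_false_of_hall hl hlu hu hsat (hT hl hlu hu) hcard (w := w) (by simpa using hw)
    rw [Finset.disjoint_left]
    intro i hi hi'
    obtain ⟨h1, h2⟩ := Finset.mem_Icc.1 hi'
    exact (mem_upDomain.1 hi).2 (derived_false_of_le hl hu h1 le_rfl h2 h)

theorem upDomain_le_nodeDomain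
    (hds : ∀ x ∈ ds, ∃ (v : Fin n) (l u : ℕ) (b : Bool),
      1 ≤ l ∧ l ≤ u ∧ u ≤ d ∧ x = rangeLit v l u b) :
    upDomain d (rootLits d D ++ ds) ≤ nodeDomain D ds := by
  intro v i hi
  obtain ⟨⟨h1, hid⟩, hnot⟩ := mem_upDomain.1 hi
  refine mem_nodeDomain.2 ⟨?_, fun l u b hb => ?_⟩
  · by_contra hD
    refine hnot (.base _ (List.mem_append_left _ (List.mem_cons_of_mem _ ?_)))
    refine List.mem_flatMap.2 ⟨v, List.mem_finRange v, List.mem_map.2 ⟨i, ?_, rfl⟩⟩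
    simp only [List.mem_filter, List.mem_range'_1, decide_eq_true_eq]
    exact ⟨by omega, hD⟩
  · obtain ⟨v', l', u', b', hl, hlu, hu, h⟩ := hds _ hb
    simp only [rangeLit, Lit.mk.injEq, NVar.atom.injEq, CAtom.base.injEq, Atom.r.injEq] at h
    obtain ⟨⟨rfl, rfl, rfl⟩, rfl⟩ := h
    have hder : Derived (allDiffNogoods n d) (rootLits d D ++ ds) (rangeLit v l u b) :=
      .base _ (List.mem_append_right _ hb)
    cases b with
    | false =>
      simp only [Bool.false_eq_true, iff_false]
      intro hi'
      obtain ⟨h3, h4⟩ := Finset.mem_Icc.1 hi'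
      exact hnot (derived_false_of_le hl hu h3 le_rfl h4 hder)
    | true =>
      obtain ⟨hleft, hright⟩ := derived_outside_false hl hlu hu hder
      simp only [iff_true]
      by_contra hi'
      rw [Finset.mem_Icc, not_and_or, not_le, not_le] at hi'
      rcases hi' with h3 | h3
      · exact hnot (derived_false_of_le le_rfl (by omega) h1 le_rfl (by omega) hleft)
      · exact hnot (derived_false_of_le (by omega) le_rfl (by omega) le_rfl hid hright)

end Node

end RangeASP

open RangeASP in
theorem mainTheorem4 :
    -- unit-propagation enforces range consistency at every node
    (∀ (n d : ℕ), 1 ≤ n → 1 ≤ d →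
      ∀ D : Fin n → Finset ℕ, (∀ v, D v ⊆ Finset.Icc 1 d) →
      ∀ ds : List (Lit (EncVar n)),
        (∀ x ∈ ds, ∃ (v : Fin n) (l u : ℕ) (b : Bool),
          1 ≤ l ∧ l ≤ u ∧ u ≤ d ∧ x = rangeLit v l u b) →
        (UPConflict (allDiffNogoods n d) (rootLits d D ++ ds) ↔
          ¬ ∃ D' : Fin n → Finset ℕ, D' ≤ nodeDomain D ds ∧ (∀ v, (D' v).Nonempty) ∧
            RangeConsistent (AllDifferent n) D') ∧
        (¬ UPConflict (allDiffNogoods n d) (rootLits d D ++ ds) →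
          (∀ v, (upDomain d (rootLits d D ++ ds) v).Nonempty) ∧
          IsGreatest {D' : Fin n → Finset ℕ | D' ≤ nodeDomain D ds ∧
            RangeConsistent (AllDifferent n) D'} (upDomain d (rootLits d D ++ ds)) ∧
          -- Hall intervals are pruned
          ∀ l u : ℕ, l ≤ u →
            {v : Fin n | upDomain d (rootLits d D ++ ds) v ⊆ Finset.Icc l u}.ncard = u - l + 1 →
            ∀ w : Fin n, ¬ upDomain d (rootLits d D ++ ds) w ⊆ Finset.Icc l u →
              Disjoint (upDomain d (rootLits d D ++ ds) w) (Finset.Icc l u))) ∧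
    -- the propagator computes unit-propagation at every node, at total cost O(n d ^ 3) on a branch
    ∃ C : ℕ, ∀ (n d : ℕ), 1 ≤ n → 1 ≤ d →
      ∀ D : Fin n → Finset ℕ, (∀ v, D v ⊆ Finset.Icc 1 d) →
      ∀ (ds : List (Lit (EncVar n))) (s : State (EncVar n)) (c : ℕ),
        Branch (allDiffNogoods n d) (rootLits d D) ds s c →
        c ≤ C * (n * d ^ 3) ∧
        (step (allDiffNogoods n d) s = none →
          (s.conflict = true ↔ UPConflict (allDiffNogoods n d) (rootLits d D ++ ds)) ∧
          (s.conflict = false →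
            ∀ x : Lit (EncVar n), s.asg x.var = some x.sign ↔
              Derived (allDiffNogoods n d) (rootLits d D ++ ds) x)) := by
  constructor
  · intro n d hn hd D hD ds hds
    set A := rootLits d D ++ ds with hA
    have hsat : Derived (allDiffNogoods n d) A ⟨.atom (.base .sat), true⟩ :=
      .base _ (List.mem_append_left _ List.mem_cons_self)
    have hle : upDomain d A ≤ nodeDomain D ds := upDomain_le_nodeDomain hds
    have hsound : ∀ E : Fin n → Finset ℕ, E ≤ nodeDomain D ds → (∀ v, (E v).Nonempty) →
        RangeConsistent (AllDifferent n) E →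
        ¬ UPConflict (allDiffNogoods n d) A ∧ E ≤ upDomain d A := fun E hE hne hrc =>
      not_conflict_of_entailed hrc hne
        (fun v i hi => hD v (mem_nodeDomain.1 (hE v hi)).1) (entailed_of_le_nodeDomain hds hE)
    refine ⟨⟨fun hU ⟨E, hE, hne, hrc⟩ => (hsound E hE hne hrc).1 hU, fun h => ?_⟩, fun hU => ?_⟩
    · by_contra hU
      exact h ⟨_, hle, upDomain_nonempty hd hU, rangeConsistent_upDomain hd hU hsat⟩
    · have hrc := rangeConsistent_upDomain hd hU hsat
      refine ⟨upDomain_nonempty hd hU, ⟨⟨hle, hrc⟩, ?_⟩, fun l u _ hcard w hw => ?_⟩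
      · rintro E ⟨hE, hErc⟩
        by_cases hne : ∀ v, (E v).Nonempty
        · exact (hsound E hE hne hErc).2
        · push Not at hne
          obtain ⟨v, hv⟩ := hne
          intro w
          rw [hErc.eq_empty hv w]
          exact Finset.empty_subset _
      · refine hrc.disjoint_of_hall ?_ hw
        rw [← hcard, ← Set.ncard_coe_finset]
        simp
  · exact ⟨1000, fun n d hn hd D _ ds s c h => ⟨h.cost_allDiff_le hn hd,
      h.halted fun δ hδ => nodup_of_mem_nogoods hδ⟩⟩
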